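/- **Lemma (Coercivity of the stabilisation).** Let $d\ge 2$, let $\Omega\subset\mathbb R^d$ be a polytopal domain, $k\in\mathbb N=\{0,1,2,\dots\}$ and $\varrho>0$. (A polytope is a connected set that is the interior of a finite union of closed nondegenerate $d$-simplices.) Then there is a constant $C>0$, depending only on $\Omega$, $k$ and $\varrho$, such that the following holds. Let $(\mathcal T_h,\mathcal F_h)$ be any polytopal mesh of $\Omega$ (finitely many disjoint polytopal elements $T$ with $\overline\Omega=\bigcup_T\overline T$; finitely many disjoint faces $F$, each a connected relatively open subset of a hyperplane whose relative boundary has zero $(d-1)$-dimensional measure, each contained in $\partial T_1\cap\partial T_2$ for two distinct elements or in $\partial T\cap\partial\Omega$ for one element, and with $\bigcup_T\partial T=\bigcup_F\overline F$) all of whose elements and faces are connected by star-shaped sets with parameter $\varrho$. The latter means, for a set $X$ of diameter $h_X$, that $X$ is a union of at most $\varrho^{-1}$ relatively open sets, each star-shaped with respect to every point of a ball of radius $\varrho h_X$, any two of which are linked by a chain of such sets in which consecutive ones share a ball of radius $\varrho h_X$ (openness and balls are relative to the affine span of $X$). Let $W(\mathcal T_h)$ be any finite-dimensional space of functions such that for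 all $\psi\in W(\mathcal T_h)$, all $T\in\mathcal T_h$ and all faces $F\subset\partial T$: $\psi\in H^1(T)$, $\Delta\psi\in L^2(T)$ and $\nabla\psi\cdot n_{TF}\in L^2(F)$, where $n_{TF}$ is the unit normal to $F$ pointing out of $T$. Denote by $W(T)$ its restriction to $T$, by $\mathcal P^m$ the polynomials of degree at most $m$, by $\mathcal T_F$ the set of elements $T$ with $F\subset\partial T$, and put $$\mathcal P^{k+1}_W(T)=\mathcal P^{k+1}(T)+W(T),\qquad \mathcal P^k_\Delta(T)=\mathcal P^k(T)+\Delta W(T),$$ $$\mathcal P^k_N(F)=\mathcal P^k(F)+\sum_{T\in\mathcal T_F}\nabla W(T)\cdot n_{TF},\qquad \mathcal P^k_N(\partial T)=\{v\in L^2(\partial T): v|_F\in \mathcal P^k_N(F)\ \text{for all faces } F\subset\partial T\}.$$ Let $\pi_T$ and $\pi_{\partial T}$ be the $L^2$-orthogonal projectors on $\mathcal P^k_\Delta(T)$ and $\mathcal P^k_N(\partial T)$. For $v=(v_T,v_{\partial T})\in\mathcal P^k_\Delta(T)\times\mathcal P^k_N(\partial T)$, let $p_Tv\in\mathcal P^{k+1}_W(T)$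 be the function with $(v_T-p_Tv,1)_T=0$ and $$(\nabla p_Tv,\nabla w)_T=-(v_T,\Delta w)_T+(v_{\partial T},\nabla w\cdot n_{\partial T})_{\partial T}\qquad\text{for all } w\in\mathcal P^{k+1}_W(T),$$ where $n_{\partial T}$ is the outward unit normal on $\partial T$. With $h_T$ the diameter of $T$, let $$s_T(u,v)=h_T^{-2}\,(u_T-\pi_Tp_Tu,\;v_T-\pi_Tp_Tv)_T+h_T^{-1}\,(u_{\partial T}-\pi_{\partial T}p_Tu,\;v_{\partial T}-\pi_{\partial T}p_Tv)_{\partial T},$$ $$a_T(u,v)=(\nabla p_Tu,\nabla p_Tv)_T+s_T(u,v),$$ traces of $p_Tu$, $p_Tv$ being understood on $\partial T$. Then for every $T\in\mathcal T_h$ and every $v\in\mathcal P^k_\Delta(T)\times\mathcal P^k_N(\partial T)$, $$h_T^{-2}\,\|v_T-p_Tv\|_{L^2(T)}^2\le C\,a_T(v,v)\qquad\text{and}\qquad h_T^{-1}\,\|v_{\partial T}-p_Tv\|_{L^2(\partial T)}^2\le C\,a_T(v,v).$$ -/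

import Mathlib

open MeasureTheory Set Filter Topology
open scoped ENNReal ContDiff

namespace XHHO

noncomputable section

/-- The Euclidean space `ℝ^d`. -/
abbrev E (d : ℕ) := EuclideanSpace ℝ (Fin d)

/-! ### Polytopal meshes -/

/-- A polytope of `ℝ^d`: a (nonempty) connected set which is the interior of a finite union of
closed nondegenerate `d`-simplices. -/
def IsPolytope {d : ℕ} (T : Set (E d)) : Prop :=
  IsConnected T ∧ ∃ S : Set (Affine.Simplex ℝ (E d) d), S.Finite ∧
    T = interior (⋃ s ∈ S, convexHull ℝ (range s.points))

/-- The surface measure of `ℝ^d`: the `(d-1)`-dimensional Hausdorff measure, normalised so that it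
is the Lebesgue measure on hyperplanes. -/
def surface (d : ℕ) : Measure (E d) := Measure.euclideanHausdorffMeasure (d - 1)

/-- A polytopal mesh of `Ω`: finitely many elements and finitely many faces. -/
structure PolytopalMesh {d : ℕ} (Ω : Set (E d)) where
  elements : Set (Set (E d))
  faces : Set (Set (E d))
  finite_elements : elements.Finite
  finite_faces : faces.Finite
  isPolytope : ∀ T ∈ elements, IsPolytope T
  elements_disjoint : elements.PairwiseDisjoint id
  closure_eq : closure Ω = ⋃ T ∈ elements, closure T
  faces_disjoint : faces.PairwiseDisjoint id
  face_subset : ∀ F ∈ faces, F ⊆ closure Ω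
  face_connected : ∀ F ∈ faces, IsConnected F
  /-- Each face is a relatively open subset of a hyperplane. -/
  face_flat : ∀ F ∈ faces, ∃ H : AffineSubspace ℝ (E d), Module.finrank ℝ H.direction + 1 = d ∧
    ∃ U : Set (E d), IsOpen U ∧ F = U ∩ (H : Set (E d))
  face_relBoundary : ∀ F ∈ faces, surface d (closure F \ F) = 0
  /-- Each face is an interface or a boundary face. -/
  face_cases : ∀ F ∈ faces,
    (∃ T₁ ∈ elements, ∃ T₂ ∈ elements, T₁ ≠ T₂ ∧ F ⊆ frontier T₁ ∩ frontier T₂) ∨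
      ∃ T ∈ elements, F ⊆ frontier T ∩ frontier Ω
  /-- The faces form the mesh skeleton. -/
  skeleton : (⋃ T ∈ elements, frontier T) = ⋃ F ∈ faces, closure F

/-- `X` is connected by star-shaped sets with parameter `ϱ`. Openness and balls are relative to the
affine span of `X`, so that the definition applies to mesh elements and to mesh faces: `X` is the
union of at most `ϱ⁻¹` relatively open sets `Y i`, each of them star-shaped with respect to every
point of a ball of radius `ϱ * diam X`, and any two of them are linked by a chain of such sets in
which consecutive ones share a ball of radius `ϱ * diam X`. -/
def ConnectedByStarShapedSets {d : ℕ} (ϱ : ℝ) (X : Set (E d)) : Prop :=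
  ∃ (N : ℕ) (Y : Fin N → Set (E d)), (N : ℝ) * ϱ ≤ 1 ∧ X = ⋃ i, Y i ∧
    (∀ i, ∃ U : Set (E d), IsOpen U ∧ Y i = U ∩ (affineSpan ℝ X : Set (E d))) ∧
    (∀ i, ∃ c ∈ affineSpan ℝ X,
      ∀ y ∈ Metric.ball c (ϱ * Metric.diam X) ∩ (affineSpan ℝ X : Set (E d)),
        y ∈ Y i ∧ StarConvex ℝ y (Y i)) ∧
    ∀ i j, Relation.ReflTransGen
      (fun a b => ∃ z ∈ affineSpan ℝ X,
        Metric.ball z (ϱ * Metric.diam X) ∩ (affineSpan ℝ X : Set (E d)) ⊆ Y a ∩ Y b) i j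

namespace PolytopalMesh

variable {d : ℕ} {Ω : Set (E d)}

/-- The mesh regularity assumption with parameter `ϱ`. -/
def Regular (M : PolytopalMesh Ω) (ϱ : ℝ) : Prop :=
  (∀ T ∈ M.elements, ConnectedByStarShapedSets ϱ T) ∧
    ∀ F ∈ M.faces, ConnectedByStarShapedSets ϱ F

/-- The faces attached to the element `T`. -/
def facesOf (M : PolytopalMesh Ω) (T : Set (E d)) : Set (Set (E d)) :=
  {F | F ∈ M.faces ∧ F ⊆ frontier T}

/-- The elements attached to the face `F`. -/
def elementsOf (M : PolytopalMesh Ω) (F : Set (E d)) : Set (Set (E d)) :=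
  {T | T ∈ M.elements ∧ F ⊆ frontier T}

end PolytopalMesh

/-! ### Function spaces on an element and on its boundary -/

section Spaces

variable {d : ℕ}

/-- `L²(T)`. -/
abbrev L2 (T : Set (E d)) := Lp ℝ 2 ((volume : Measure (E d)).restrict T)

/-- `L²(T)^d`. -/
abbrev L2V (T : Set (E d)) := Lp (E d) 2 ((volume : Measure (E d)).restrict T)

/-- `L²(F)` for a subset `F` of a finite union of hyperplanes. -/
abbrev L2F (F : Set (E d)) := Lp ℝ 2 ((surface d).restrict F)

/-- `L²(∂T)`. -/
abbrev L2B (T : Set (E d)) := L2F (frontier T)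

/-- Test functions on `ℝ^d`. -/
def IsTest (φ : E d → ℝ) : Prop := ContDiff ℝ ∞ φ ∧ HasCompactSupport φ

/-- `H¹(T)`, as the set of the pairs `(u, ∇u)` in `L²(T) × L²(T)^d`, where `∇u` is the weak
gradient of `u` in `T`. -/
def H1 (T : Set (E d)) : Set (L2 T × L2V T) :=
  {u | ∀ φ : E d → ℝ, IsTest φ → tsupport φ ⊆ T →
    ∫ x in T, u.1 x • gradient φ x = -∫ x in T, φ x • u.2 x}

/-- `l = Δu` weakly in `T`, for `u = (u, ∇u) ∈ H¹(T)`. -/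
def IsLaplacian (T : Set (E d)) (u : L2 T × L2V T) (l : L2 T) : Prop :=
  ∀ φ : E d → ℝ, IsTest φ → tsupport φ ⊆ T →
    ∫ x in T, inner ℝ (u.2 x) (gradient φ x) = -∫ x in T, l x * φ x

/-- `q = ∇u · n_{TF}` on the face `F ⊆ ∂T`, for `u = (u, ∇u) ∈ H¹(T)` with `Δu = l ∈ L²(T)`:
Green's formula in `T` holds for all test functions which on `∂T` are supported in `F`. -/
def IsNormalDeriv (T F : Set (E d)) (u : L2 T × L2V T) (l : L2 T) (q : E d → ℝ) : Prop :=
  ∀ φ : E d → ℝ, IsTest φ → tsupport φ ∩ frontier T ⊆ F →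
    ∫ x in T, inner ℝ (u.2 x) (gradient φ x) =
      -(∫ x in T, l x * φ x) + ∫ x in F, φ x * q x ∂(surface d)

/-- The triples `(φ, ∇φ, φ|_{∂T})` in `L²(T) × L²(T)^d × L²(∂T)`, `φ` a test function on `ℝ^d`. -/
def smoothTriples (T : Set (E d)) : Set (L2 T × L2V T × L2B T) :=
  {t | ∃ φ : E d → ℝ, IsTest φ ∧ t.1 =ᵐ[volume.restrict T] φ ∧
    t.2.1 =ᵐ[volume.restrict T] gradient φ ∧ t.2.2 =ᵐ[(surface d).restrict (frontier T)] φ}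

/-- `g ∈ L²(∂T)` is the trace of `u = (u, ∇u) ∈ H¹(T)` on `∂T`: there are test functions on `ℝ^d`
which converge to `u` in `H¹(T)` and whose restrictions to `∂T` converge to `g` in `L²(∂T)`. -/
def IsTrace (T : Set (E d)) (u : L2 T × L2V T) (g : L2B T) : Prop :=
  (u.1, u.2, g) ∈ closure (smoothTriples T)

open Classical in
/-- The trace operator `H¹(T) → L²(∂T)`. -/
def trace (T : Set (E d)) (u : L2 T × L2V T) : L2B T :=
  if h : ∃ g, IsTrace T u g then h.choose else 0

/-- Polynomials of total degree at most `k`, as a subspace of `L²(μ)`. -/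
def polySpace (k : ℕ) (μ : Measure (E d)) : Submodule ℝ (Lp ℝ 2 μ) :=
  Submodule.span ℝ {f | ∃ q : MvPolynomial (Fin d) ℝ, q.totalDegree ≤ k ∧
    f =ᵐ[μ] fun x => MvPolynomial.eval (fun i => x i) q}

/-- The orthogonal projector on a subspace of a Hilbert space. It is used for finite-dimensional
`S` only, and such a subspace is its own closure; in general it projects on the closure of `S`. -/
def proj {H : Type*} [NormedAddCommGroup H] [InnerProductSpace ℝ H] [CompleteSpace H]
    (S : Submodule ℝ H) (f : H) : H :=
  S.topologicalClosure.starProjection f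

end Spaces

/-! ### The enriched spaces -/

section Enriched

variable {d : ℕ} {Ω : Set (E d)}

/-- The enrichment space `W` satisfies, for every `ψ ∈ W` and every element `T`:
`ψ ∈ H¹(T)`, `Δψ ∈ L²(T)`, and `∇ψ · n_{TF} ∈ L²(F)` for every face `F` of `T`. -/
structure IsEnrichment (M : PolytopalMesh Ω) (W : Submodule ℝ (E d → ℝ)) : Prop where
  mem_H1 : ∀ ψ ∈ W, ∀ T ∈ M.elements, ∃ u ∈ H1 T, u.1 =ᵐ[volume.restrict T] ψ
  laplacian : ∀ ψ ∈ W, ∀ T ∈ M.elements, ∀ u ∈ H1 T, u.1 =ᵐ[volume.restrict T] ψ →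
    ∃ l, IsLaplacian T u l
  normal : ∀ ψ ∈ W, ∀ T ∈ M.elements, ∀ u ∈ H1 T, u.1 =ᵐ[volume.restrict T] ψ →
    ∀ l, IsLaplacian T u l → ∀ F ∈ M.facesOf T, ∃ q : L2F F, IsNormalDeriv T F u l q

/-- The extended space of degree `k` on `T`: polynomials of degree at most `k` plus `W(T)`, as
elements of `H¹(T)`. -/
def extSpace (W : Submodule ℝ (E d → ℝ)) (k : ℕ) (T : Set (E d)) : Set (L2 T × L2V T) :=
  {u | u ∈ H1 T ∧ ∃ q : MvPolynomial (Fin d) ℝ, q.totalDegree ≤ k ∧ ∃ ψ ∈ W,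
    u.1 =ᵐ[volume.restrict T] fun x => MvPolynomial.eval (fun i => x i) q + ψ x}

/-- `ΔW(T) ⊆ L²(T)`. -/
def lapSpace (W : Submodule ℝ (E d → ℝ)) (T : Set (E d)) : Submodule ℝ (L2 T) :=
  Submodule.span ℝ {l | ∃ ψ ∈ W, ∃ u ∈ H1 T, u.1 =ᵐ[volume.restrict T] ψ ∧ IsLaplacian T u l}

/-- `∇W(T) · n_{TF} ⊆ L²(F)`. -/
def normalSpace (W : Submodule ℝ (E d → ℝ)) (T F : Set (E d)) : Submodule ℝ (L2F F) :=
  Submodule.span ℝ {q | ∃ ψ ∈ W, ∃ u ∈ H1 T, u.1 =ᵐ[volume.restrict T] ψ ∧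
    ∃ l, IsLaplacian T u l ∧ IsNormalDeriv T F u l q}

/-- The space of element unknowns: polynomials of degree at most `k` plus `ΔW(T)`. -/
def cellSpace (W : Submodule ℝ (E d → ℝ)) (k : ℕ) (T : Set (E d)) : Submodule ℝ (L2 T) :=
  polySpace k (volume.restrict T) ⊔ lapSpace W T

/-- The space of unknowns on a face: polynomials of degree at most `k` plus the normal derivatives
of `W` from the elements attached to `F`. -/
def faceSpace (M : PolytopalMesh Ω) (W : Submodule ℝ (E d → ℝ)) (k : ℕ) (F : Set (E d)) :
    Submodule ℝ (L2F F) :=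
  polySpace k ((surface d).restrict F) ⊔ ⨆ T ∈ M.elementsOf F, normalSpace W T F

/-- The functions on `∂T` whose restriction to each face `F` of `T` is in the space of `F`. -/
def bdrySpace (M : PolytopalMesh Ω) (W : Submodule ℝ (E d → ℝ)) (k : ℕ) (T : Set (E d)) :
    Submodule ℝ (L2B T) where
  carrier := {g | ∀ F ∈ M.facesOf T, ∃ h ∈ faceSpace M W k F, g =ᵐ[(surface d).restrict F] h}
  zero_mem' := by
    intro F hF
    refine ⟨0, Submodule.zero_mem _, ?_⟩
    have h0 : ((0 : L2B T) : E d → ℝ) =ᵐ[(surface d).restrict F] 0 :=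
      ae_restrict_of_ae_restrict_of_subset hF.2 (Lp.coeFn_zero _ _ _)
    exact h0.trans (Lp.coeFn_zero _ _ _).symm
  add_mem' := by
    intro a b ha hb F hF
    obtain ⟨h, hh, hah⟩ := ha F hF
    obtain ⟨h', hh', hbh⟩ := hb F hF
    refine ⟨h + h', Submodule.add_mem _ hh hh', ?_⟩
    have h0 : ((a + b : L2B T) : E d → ℝ) =ᵐ[(surface d).restrict F] a + b :=
      ae_restrict_of_ae_restrict_of_subset hF.2 (Lp.coeFn_add _ _)
    exact (h0.trans (hah.add hbh)).trans (Lp.coeFn_add _ _).symm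
  smul_mem' := by
    intro c a ha F hF
    obtain ⟨h, hh, hah⟩ := ha F hF
    refine ⟨c • h, Submodule.smul_mem _ c hh, ?_⟩
    have h0 : ((c • a : L2B T) : E d → ℝ) =ᵐ[(surface d).restrict F] c • (a : E d → ℝ) :=
      ae_restrict_of_ae_restrict_of_subset hF.2 (Lp.coeFn_smul _ _)
    exact (h0.trans (hah.const_smul c)).trans (Lp.coeFn_smul _ _).symm

/-- The local space of unknowns `v = (v_T, v_{∂T})`. -/
def localSpace (M : PolytopalMesh Ω) (W : Submodule ℝ (E d → ℝ)) (k : ℕ) (T : Set (E d)) :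
    Submodule ℝ (L2 T × L2B T) :=
  (cellSpace W k T).prod (bdrySpace M W k T)

/-! ### Reconstruction, stabilisation and local bilinear form -/

/-- `p` is the potential reconstruction of `v = (v_T, v_{∂T})`: it is in the extended space of
degree `k + 1`, satisfies `(∇p, ∇w)_T = -(v_T, Δw)_T + (v_{∂T}, ∇w · n)_{∂T}` for all `w` in this
space, and has the same mean value on `T` as `v_T`. -/
def IsReconstruction (M : PolytopalMesh Ω) (W : Submodule ℝ (E d → ℝ)) (k : ℕ) (T : Set (E d))
    (v : L2 T × L2B T) (p : L2 T × L2V T) : Prop :=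
  p ∈ extSpace W (k + 1) T ∧
  (∀ w ∈ extSpace W (k + 1) T, ∀ (l : L2 T) (q : L2B T), IsLaplacian T w l →
    (∀ F ∈ M.facesOf T, IsNormalDeriv T F w l q) →
      inner ℝ p.2 w.2 = -inner ℝ v.1 l + inner ℝ v.2 q) ∧
  ∫ x in T, (v.1 x - p.1 x) = 0

open Classical in
/-- The reconstruction operator `v ↦ p_T v`. -/
def recon (M : PolytopalMesh Ω) (W : Submodule ℝ (E d → ℝ)) (k : ℕ) (T : Set (E d))
    (v : L2 T × L2B T) : L2 T × L2V T :=
  if h : ∃ p, IsReconstruction M W k T v p then h.choose else 0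

/-- The element difference operator `v ↦ v_T - π_T p_T v`. -/
def deltaCell (M : PolytopalMesh Ω) (W : Submodule ℝ (E d → ℝ)) (k : ℕ) (T : Set (E d))
    (v : L2 T × L2B T) : L2 T :=
  v.1 - proj (cellSpace W k T) (recon M W k T v).1

/-- The boundary difference operator `v ↦ v_{∂T} - π_{∂T} p_T v`. -/
def deltaBdry (M : PolytopalMesh Ω) (W : Submodule ℝ (E d → ℝ)) (k : ℕ) (T : Set (E d))
    (v : L2 T × L2B T) : L2B T :=
  v.2 - proj (bdrySpace M W k T) (trace T (recon M W k T v))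

/-- The stabilisation `s_T`. -/
def stab (M : PolytopalMesh Ω) (W : Submodule ℝ (E d → ℝ)) (k : ℕ) (T : Set (E d))
    (u v : L2 T × L2B T) : ℝ :=
  (Metric.diam T ^ 2)⁻¹ * inner ℝ (deltaCell M W k T u) (deltaCell M W k T v) +
    (Metric.diam T)⁻¹ * inner ℝ (deltaBdry M W k T u) (deltaBdry M W k T v)

/-- The local form `a_T(u, v) = (∇p_T u, ∇p_T v)_T + s_T(u, v)`. -/
def localForm (M : PolytopalMesh Ω) (W : Submodule ℝ (E d → ℝ)) (k : ℕ) (T : Set (E d))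
    (u v : L2 T × L2B T) : ℝ :=
  inner ℝ (recon M W k T u).2 (recon M W k T v).2 + stab M W k T u v

end Enriched

end

end XHHO

/-! For every p ∈ H¹(T), ‖v_T − p‖² ≤ 2‖v_T − π_T p‖² + 2‖p − π_T p‖², and likewise on ∂T. For p =
p_T v the first terms, scaled, are the two parts of s_T(v, v), so it remains to bound the projection
errors of p by ∇p. Constants belong to both target spaces, so by best approximation it is enough to
find constants m, m' with ‖p − m‖_T ≤ C h_T ‖∇p‖_T and ‖p − m'‖_∂T ≤ C h_T^{1/2} ‖∇p‖_T, where C is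
explicit in d and ϱ.

Poincaré: on a star-shaped piece, u(x) − u(y) is the integral of ∇u along the segment from y, for y
in the ball of star-shapedness. Integrating over x and y bounds the double integral without a
singular kernel (`lintegral_segment_le`), and mollification carries this to H¹(T)
(`H1.exists_const_lintegral_sub_le`). Pieces that share a ball have close constants, and at most N
pieces have to be crossed (`exists_const_lintegral_sub_le_of_chain`).

Trace: for smooth f, s^d f² is differentiated along the rays from the centre of a piece
(`enorm_sq_le_lintegral_ray`) and integrated over cones with base on ∂T (`lintegral_cone_le`). The
cones are disjoint, and their heights are at least ϱ h_T, because a hyperplane which alone carries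
∂T near a point of the closure of the piece cannot cut the ball (`IsPolytope.lintegral_surface_le`).
The resulting bound is closed under the limits that define the trace. -/

namespace XHHO

/-! ### Averages over segments joining two sets -/

theorem lintegral_comp_smul_add_le {d : ℕ} {g : E d → ℝ≥0∞} (hg : Measurable g) {r : ℝ}
    (hr : 1 / 2 ≤ r) (w : E d) : ∫⁻ y, g (r • y + w) ≤ 2 ^ d * ∫⁻ z, g z := by
  have hr0 : r ≠ 0 := by linarith
  have hmap := Measure.map_addHaar_smul (volume : Measure (E d)) hr0
  have hg' : Measurable fun z => g (z + w) := hg.comp (measurable_id.add_const w)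
  have h1 : ∫⁻ y, g (r • y + w) = ∫⁻ z, g (z + w) ∂(Measure.map (r • ·) volume) := by
    rw [lintegral_map hg' (measurable_const_smul r)]
  rw [h1, hmap, lintegral_smul_measure, lintegral_add_right_eq_self, smul_eq_mul]
  gcongr
  have h2 : |(r ^ Module.finrank ℝ (E d))⁻¹| ≤ 2 ^ d := by
    rw [finrank_euclideanSpace, Fintype.card_fin, ← inv_pow, abs_of_nonneg (by positivity)]
    gcongr
    rw [inv_le_comm₀ (by linarith) (by norm_num)]
    linarith
  calc ENNReal.ofReal |(r ^ Module.finrank ℝ (E d))⁻¹| ≤ ENNReal.ofReal (2 ^ d) :=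
        ENNReal.ofReal_le_ofReal h2
    _ = 2 ^ d := by rw [ENNReal.ofReal_pow (by norm_num)]; simp

/-- The point y + s(x − y) has weight 1 − s on y and s on x. For s ≤ 1/2 substitute in y, for s ≥
1/2 in x: the Jacobian never exceeds 2^d. The variable left over contributes the factor |Y| or |B|.
-/
theorem lintegral_segment_le {d : ℕ} {g : E d → ℝ≥0∞} (hg : Measurable g) (Y B : Set (E d)) :
    ∫⁻ x in Y, ∫⁻ y in B, ∫⁻ s in Ioo (0 : ℝ) 1, g (y + s • (x - y)) ≤
      2 ^ d * (volume Y + volume B) * ∫⁻ z, g z := by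
  have hsplit : Ioo (0 : ℝ) 1 ⊆ Ioc 0 (1 / 2) ∪ Ico (1 / 2) 1 := by
    intro s hs
    rcases le_total s (1 / 2) with h | h
    · exact Or.inl ⟨hs.1, h⟩
    · exact Or.inr ⟨h, hs.2⟩
  have hA : ∀ x : E d, ∫⁻ y in B, ∫⁻ s in Ioc (0 : ℝ) (1 / 2), g (y + s • (x - y)) ≤
      2 ^ d * ∫⁻ z, g z := by
    intro x
    rw [lintegral_lintegral_swap (f := fun y (s : ℝ) => g (y + s • (x - y)))
      (hg.comp (g := g) (by fun_prop)).aemeasurable]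
    calc ∫⁻ s in Ioc (0 : ℝ) (1 / 2), ∫⁻ y in B, g (y + s • (x - y))
        ≤ ∫⁻ s in Ioc (0 : ℝ) (1 / 2), 2 ^ d * ∫⁻ z, g z := by
          refine setLIntegral_mono measurable_const fun s hs => ?_
          refine (setLIntegral_le_lintegral _ _).trans ?_
          have := lintegral_comp_smul_add_le hg (r := 1 - s) (by linarith [hs.2]) (s • x)
          refine le_trans (le_of_eq ?_) this
          congr 1; ext y; congr 1; module
      _ ≤ 2 ^ d * ∫⁻ z, g z := by
          rw [setLIntegral_const, Real.volume_Ioc]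
          refine mul_le_of_le_one_right' ?_
          rw [ENNReal.ofReal_le_one]; norm_num
  have hB : ∀ y : E d, ∫⁻ x in Y, ∫⁻ s in Ico (1 / 2 : ℝ) 1, g (y + s • (x - y)) ≤
      2 ^ d * ∫⁻ z, g z := by
    intro y
    rw [lintegral_lintegral_swap (f := fun x (s : ℝ) => g (y + s • (x - y)))
      (hg.comp (g := g) (by fun_prop)).aemeasurable]
    calc ∫⁻ s in Ico (1 / 2 : ℝ) 1, ∫⁻ x in Y, g (y + s • (x - y))
        ≤ ∫⁻ s in Ico (1 / 2 : ℝ) 1, 2 ^ d * ∫⁻ z, g z := by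
          refine setLIntegral_mono measurable_const fun s hs => ?_
          refine (setLIntegral_le_lintegral _ _).trans ?_
          have := lintegral_comp_smul_add_le hg (r := s) hs.1 ((1 - s) • y)
          refine le_trans (le_of_eq ?_) this
          congr 1; ext x; congr 1; module
      _ ≤ 2 ^ d * ∫⁻ z, g z := by
          rw [setLIntegral_const, Real.volume_Ico]
          refine mul_le_of_le_one_right' ?_
          rw [ENNReal.ofReal_le_one]; norm_num
  have hm1 : ∀ S : Set ℝ, Measurable fun p : E d × E d =>
      ∫⁻ s in S, g (p.2 + s • (p.1 - p.2)) := by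
    intro S
    exact Measurable.lintegral_prod_right' (f := fun q : (E d × E d) × ℝ =>
      g (q.1.2 + q.2 • (q.1.1 - q.1.2))) (hg.comp (by fun_prop))
  have hm2 : ∀ (S : Set ℝ) (x : E d), Measurable fun y : E d =>
      ∫⁻ s in S, g (y + s • (x - y)) := fun S x =>
    (hm1 S).comp (measurable_const.prodMk measurable_id : Measurable fun y : E d => (x, y))
  have hm3 : ∀ S : Set ℝ, Measurable fun x : E d =>
      ∫⁻ y in B, ∫⁻ s in S, g (y + s • (x - y)) := fun S =>
    Measurable.lintegral_prod_right' (f := fun p : E d × E d =>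
      ∫⁻ s in S, g (p.2 + s • (p.1 - p.2))) (hm1 S)
  calc ∫⁻ x in Y, ∫⁻ y in B, ∫⁻ s in Ioo (0 : ℝ) 1, g (y + s • (x - y))
      ≤ ∫⁻ x in Y, ∫⁻ y in B, ((∫⁻ s in Ioc (0 : ℝ) (1 / 2), g (y + s • (x - y))) +
          ∫⁻ s in Ico (1 / 2 : ℝ) 1, g (y + s • (x - y))) := by
        refine lintegral_mono fun x => lintegral_mono fun y => ?_
        exact (lintegral_mono_set hsplit).trans (lintegral_union_le _ _ _)
    _ = (∫⁻ x in Y, ∫⁻ y in B, ∫⁻ s in Ioc (0 : ℝ) (1 / 2), g (y + s • (x - y))) +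
          ∫⁻ x in Y, ∫⁻ y in B, ∫⁻ s in Ico (1 / 2 : ℝ) 1, g (y + s • (x - y)) := by
        rw [← lintegral_add_left (hm3 _)]
        refine lintegral_congr fun x => ?_
        rw [lintegral_add_left (hm2 _ x)]
    _ ≤ (∫⁻ x in Y, 2 ^ d * ∫⁻ z, g z) + ∫⁻ y in B, 2 ^ d * ∫⁻ z, g z := by
        refine add_le_add (lintegral_mono fun x => hA x) ?_
        rw [lintegral_lintegral_swap (hm1 _).aemeasurable]
        exact lintegral_mono fun y => hB y
    _ = 2 ^ d * (volume Y + volume B) * ∫⁻ z, g z := by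
        rw [setLIntegral_const, setLIntegral_const]; ring

/-- The lower limit accommodates H¹ functions, whose difference is controlled only through mollified
gradients, from an index that depends on the pair (x, y). Fatou's lemma in each variable moves it
outside, where the bound is uniform in n. -/
theorem exists_const_lintegral_sub_le {d : ℕ} {Y B : Set (E d)} {U : E d → ℝ} (hU : Measurable U)
    (hB0 : volume B ≠ 0) (hB : volume B ≠ ⊤) {g : ℕ → E d → ℝ≥0∞} (hg : ∀ n, Measurable (g n))
    {I : ℝ≥0∞} (hI : ∀ n, ∫⁻ z, g n z ≤ I)
    (h : ∀ᵐ x ∂volume.restrict Y, ∀ᵐ y ∂volume.restrict B, ‖U x - U y‖ₑ ^ 2 ≤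
      liminf (fun n => ∫⁻ s in Ioo (0 : ℝ) 1, g n (y + s • (x - y))) atTop) :
    ∃ m : ℝ, volume B * ∫⁻ x in Y, ‖U x - m‖ₑ ^ 2 ≤ 2 ^ d * (volume Y + volume B) * I := by
  have hm1 : ∀ n, Measurable fun p : E d × E d =>
      ∫⁻ s in Ioo (0 : ℝ) 1, g n (p.2 + s • (p.1 - p.2)) := fun n =>
    Measurable.lintegral_prod_right' (f := fun q : (E d × E d) × ℝ =>
      g n (q.1.2 + q.2 • (q.1.1 - q.1.2))) ((hg n).comp (by fun_prop))
  have hUm : Measurable fun p : E d × E d => ‖U p.1 - U p.2‖ₑ ^ 2 := by fun_prop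
  have key : ∫⁻ x in Y, ∫⁻ y in B, ‖U x - U y‖ₑ ^ 2 ≤ 2 ^ d * (volume Y + volume B) * I := by
    calc ∫⁻ x in Y, ∫⁻ y in B, ‖U x - U y‖ₑ ^ 2
        ≤ ∫⁻ x in Y, ∫⁻ y in B,
            liminf (fun n => ∫⁻ s in Ioo (0 : ℝ) 1, g n (y + s • (x - y))) atTop := by
          refine lintegral_mono_ae ?_
          filter_upwards [h] with x hx
          exact lintegral_mono_ae hx
      _ ≤ ∫⁻ x in Y, liminf (fun n => ∫⁻ y in B,
            ∫⁻ s in Ioo (0 : ℝ) 1, g n (y + s • (x - y))) atTop := by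
          refine lintegral_mono fun x => lintegral_liminf_le fun n => ?_
          exact (hm1 n).comp (measurable_const.prodMk measurable_id :
            Measurable fun y : E d => (x, y))
      _ ≤ liminf (fun n => ∫⁻ x in Y, ∫⁻ y in B,
            ∫⁻ s in Ioo (0 : ℝ) 1, g n (y + s • (x - y))) atTop :=
          lintegral_liminf_le fun n => Measurable.lintegral_prod_right' (hm1 n)
      _ ≤ 2 ^ d * (volume Y + volume B) * I := by
          refine liminf_le_of_le (by isBoundedDefault) fun b hb => ?_
          obtain ⟨n, hn⟩ := hb.exists
          refine hn.trans ((lintegral_segment_le (hg n) Y B).trans ?_)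
          gcongr
          exact hI n
  rw [lintegral_lintegral_swap hUm.aemeasurable] at key
  have hFm : Measurable fun y => ∫⁻ x in Y, ‖U x - U y‖ₑ ^ 2 :=
    Measurable.lintegral_prod_right' (f := fun p : E d × E d => ‖U p.2 - U p.1‖ₑ ^ 2)
      (by fun_prop)
  -- The constant is a value of U, at a y where the integral over Y is at most its average over B.
  obtain ⟨y, -, hy⟩ := exists_le_setLAverage hB0 hB hFm.aemeasurable
  refine ⟨U y, le_trans ?_ key⟩
  rw [setLAverage_eq] at hy
  calc _ ≤ volume B * ((∫⁻ y in B, ∫⁻ x in Y, ‖U x - U y‖ₑ ^ 2) / volume B) := by gcongr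
    _ ≤ _ := ENNReal.mul_div_le

/-! ### Mollification, and the Poincaré inequality on a set seen from another set -/

theorem sq_lintegral_le {α : Type*} [MeasurableSpace α] (μ : Measure α) {f : α → ℝ≥0∞}
    (hf : AEMeasurable f μ) : (∫⁻ a, f a ∂μ) ^ 2 ≤ μ univ * ∫⁻ a, f a ^ 2 ∂μ := by
  have h := ENNReal.lintegral_mul_le_Lp_mul_Lq μ Real.HolderConjugate.two_two hf
    (aemeasurable_const (b := (1 : ℝ≥0∞)))
  simp only [Pi.mul_apply, mul_one, ENNReal.rpow_two, one_pow, lintegral_const, one_mul] at h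
  calc (∫⁻ a, f a ∂μ) ^ 2
      ≤ ((∫⁻ a, f a ^ 2 ∂μ) ^ (1 / 2 : ℝ) * (μ univ) ^ (1 / 2 : ℝ)) ^ 2 := by gcongr
    _ = μ univ * ∫⁻ a, f a ^ 2 ∂μ := by
        rw [mul_pow, ← ENNReal.rpow_two, ← ENNReal.rpow_two, ← ENNReal.rpow_mul,
          ← ENNReal.rpow_mul]
        norm_num [mul_comm]

theorem enorm_sub_sq_le_lintegral_fderiv {d : ℕ} {f : E d → ℝ} (hf : ContDiff ℝ 1 f) (x y : E d) :
    ‖f x - f y‖ₑ ^ 2 ≤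
      ∫⁻ s in Ioo (0 : ℝ) 1, ‖fderiv ℝ f (y + s • (x - y)) (x - y)‖ₑ ^ 2 := by
  have hc : Continuous fun s : ℝ => fderiv ℝ f (y + s • (x - y)) (x - y) :=
    ((hf.continuous_fderiv one_ne_zero).comp (by fun_prop)).clm_apply continuous_const
  have hd : ∀ s : ℝ, HasDerivAt (fun s : ℝ => f (y + s • (x - y)))
      (fderiv ℝ f (y + s • (x - y)) (x - y)) s := by
    intro s
    have h1 : HasDerivAt (fun s : ℝ => y + s • (x - y)) (x - y) s := by
      simpa using ((hasDerivAt_id s).smul_const (x - y)).const_add y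
    exact (hf.differentiable one_ne_zero _).hasFDerivAt.comp_hasDerivAt s h1
  have hi := intervalIntegral.integral_eq_sub_of_hasDerivAt (a := 0) (b := 1)
    (fun s _ => hd s) (hc.intervalIntegrable _ _)
  have h01 : f x - f y = ∫ s in Ioo (0 : ℝ) 1, fderiv ℝ f (y + s • (x - y)) (x - y) := by
    rw [← integral_Ioc_eq_integral_Ioo, ← intervalIntegral.integral_of_le zero_le_one, hi]
    simp
  rw [h01]
  calc _ ≤ (∫⁻ s in Ioo (0 : ℝ) 1, ‖fderiv ℝ f (y + s • (x - y)) (x - y)‖ₑ) ^ 2 := by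
        gcongr; exact enorm_integral_le_lintegral_enorm _
    _ ≤ _ := by
        refine (sq_lintegral_le _ hc.enorm.measurable.aemeasurable).trans ?_
        simp

theorem enorm_fderiv_apply_le_gradient {d : ℕ} (f : E d → ℝ) (z v : E d) :
    ‖fderiv ℝ f z v‖ₑ ≤ ‖gradient f z‖ₑ * ‖v‖ₑ := by
  rw [← inner_gradient_left]
  rw [← ofReal_norm, ← ofReal_norm, ← ofReal_norm, ← ENNReal.ofReal_mul (norm_nonneg _)]
  exact ENNReal.ofReal_le_ofReal (norm_inner_le_norm _ _)

theorem gradient_comp_const_sub {d : ℕ} {f : E d → ℝ} (hf : Differentiable ℝ f) (z t : E d) :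
    gradient (fun t => f (z - t)) t = -gradient f (z - t) := by
  have h1 : HasFDerivAt (fun t => f (z - t)) ((fderiv ℝ f (z - t)).comp
      (-ContinuousLinearMap.id ℝ (E d))) t :=
    (hf (z - t)).hasFDerivAt.comp t ((hasFDerivAt_id t).const_sub z)
  refine ext_inner_right ℝ fun v => ?_
  rw [inner_gradient_left, h1.fderiv, inner_neg_left, inner_gradient_left]
  simp

theorem locallyIntegrable_indicator_Lp {d : ℕ} {F : Type*} [NormedAddCommGroup F]
    {T : Set (E d)} (hT : MeasurableSet T)
    (u : Lp F 2 ((volume : Measure (E d)).restrict T)) :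
    LocallyIntegrable (T.indicator u) (volume : Measure (E d)) :=
  ((memLp_indicator_iff_restrict hT).2 (Lp.memLp u)).locallyIntegrable (by norm_num)

open scoped Convolution

/-- The mollification of an element of `H¹(T)` has the mollified gradient as gradient, at the points
whose distance to the complement of `T` is larger than the radius of the mollifier. -/
theorem fderiv_convolution_eq_inner {d : ℕ} {T : Set (E d)} (hT : IsOpen T) {u : L2 T × L2V T}
    (hu : u ∈ H1 T) (η : ContDiffBump (0 : E d)) {z : E d}
    (hz : Metric.closedBall z η.rOut ⊆ T) (v : E d) :
    fderiv ℝ (η.normed volume ⋆[ContinuousLinearMap.lsmul ℝ ℝ, volume] T.indicator u.1) z v =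
      inner ℝ (∫ t, η.normed volume (z - t) • T.indicator u.2 t) v := by
  set e := η.normed (volume : Measure (E d)) with he
  have hcs : HasCompactSupport e := η.hasCompactSupport_normed
  have hsm : ContDiff ℝ ∞ e := η.contDiff_normed (n := ⊤)
  have hsm1 : ContDiff ℝ 1 e := η.contDiff_normed (n := 1)
  have hdiff : Differentiable ℝ e := hsm1.differentiable one_ne_zero
  have hU := locallyIntegrable_indicator_Lp hT.measurableSet u.1
  set φ : E d → ℝ := fun t => e (z - t) with hφ
  -- The reflected mollifier centred at z is supported in T, hence admissible in the definition of
  -- the weak gradient.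
  have hhom : φ = e ∘ Homeomorph.subLeft z := rfl
  have hφs : tsupport φ ⊆ Metric.closedBall z η.rOut := by
    refine closure_minimal ?_ Metric.isClosed_closedBall
    intro t ht
    have : z - t ∈ tsupport e := subset_tsupport _ ht
    rw [he, η.tsupport_normed_eq] at this
    rw [Metric.mem_closedBall, dist_comm, dist_eq_norm]
    simpa using this
  have hφc : HasCompactSupport φ := hcs.comp_homeomorph (Homeomorph.subLeft z)
  have hφsm : ContDiff ℝ ∞ φ := hsm.comp (contDiff_const.sub contDiff_id)
  have hφ1 : ContDiff ℝ 1 φ := hsm1.comp (contDiff_const.sub contDiff_id)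
  have key := hu φ ⟨hφsm, hφc⟩ (hφs.trans hz)
  have hgc : Continuous (gradient φ) :=
    (InnerProductSpace.toDual ℝ (E d)).symm.continuous.comp (hφ1.continuous_fderiv one_ne_zero)
  have hgs : HasCompactSupport (gradient φ) :=
    (hφc.fderiv ℝ).comp_left (g := (InnerProductSpace.toDual ℝ (E d)).symm) (map_zero _)
  have hint : Integrable (fun t => T.indicator u.1 t • gradient φ t) volume :=
    hU.integrable_smul_right_of_hasCompactSupport hgc hgs
  have h1 : ∫ t, T.indicator u.1 t • gradient φ t = -∫ t, φ t • T.indicator u.2 t := by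
    have a1 : (fun t => T.indicator u.1 t • gradient φ t) =
        T.indicator (fun t => u.1 t • gradient φ t) := by
      ext1 t; by_cases ht : t ∈ T <;> simp [ht]
    have a2 : (fun t => φ t • T.indicator u.2 t) = T.indicator (fun t => φ t • u.2 t) := by
      ext1 t; by_cases ht : t ∈ T <;> simp [ht]
    rw [a1, a2, integral_indicator hT.measurableSet, integral_indicator hT.measurableSet, key]
  have hfd := (hcs.hasFDerivAt_convolution_left (ContinuousLinearMap.lsmul ℝ ℝ) hsm1 hU z).fderiv
  have hex : ConvolutionExistsAt (fderiv ℝ e) (T.indicator u.1) z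
      ((ContinuousLinearMap.lsmul ℝ ℝ).precompL (E d)) volume :=
    (hcs.fderiv ℝ).convolutionExists_left _ (hsm1.continuous_fderiv one_ne_zero) hU z
  rw [hfd, convolution_eq_swap, ContinuousLinearMap.integral_apply hex.integrable_swap]
  have h2 : inner ℝ v (∫ t, φ t • T.indicator u.2 t) =
      -∫ t, inner ℝ v (T.indicator u.1 t • gradient φ t) := by
    rw [integral_inner hint, h1, inner_neg_right, neg_neg]
  rw [real_inner_comm, h2, ← integral_neg]
  congr 1
  ext1 t
  rw [ContinuousLinearMap.precompL_apply, gradient_comp_const_sub hdiff, smul_neg, inner_neg_right,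
    neg_neg, inner_smul_right, real_inner_comm, inner_gradient_left]
  simp [mul_comm]

theorem lintegral_enorm_normed {d : ℕ} (η : ContDiffBump (0 : E d)) :
    ∫⁻ t, ‖η.normed volume t‖ₑ = 1 := by
  have h1 := ofReal_integral_eq_lintegral_ofReal (η.integrable_normed (μ := volume))
    (Eventually.of_forall fun x => η.nonneg_normed x)
  rw [η.integral_normed, ENNReal.ofReal_one] at h1
  rw [h1]
  exact lintegral_congr fun t => Real.enorm_eq_ofReal (η.nonneg_normed t)

/-- Convolution with a kernel of unit mass is a contraction of L². The measure |e(z − t)| dt is a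
probability, so Cauchy–Schwarz moves the square inside; Tonelli and translation invariance finish.
-/
theorem lintegral_enorm_convolution_sq_le {d : ℕ} {F : Type*} [NormedAddCommGroup F]
    [NormedSpace ℝ F] {V : E d → F} (hV : StronglyMeasurable V) {e : E d → ℝ} (hec : Continuous e)
    (hone : ∫⁻ t, ‖e t‖ₑ = 1) :
    ∫⁻ z, ‖∫ t, e (z - t) • V t‖ₑ ^ 2 ≤ ∫⁻ t, ‖V t‖ₑ ^ 2 := by
  have hee : Measurable fun q : E d × E d => ‖e (q.1 - q.2)‖ₑ :=
    (hec.comp (by fun_prop : Continuous fun q : E d × E d => q.1 - q.2)).enorm.measurable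
  have hpt : ∀ z, ‖∫ t, e (z - t) • V t‖ₑ ^ 2 ≤ ∫⁻ t, ‖e (z - t)‖ₑ * ‖V t‖ₑ ^ 2 := by
    intro z
    have hez : Measurable fun t => ‖e (z - t)‖ₑ :=
      hee.comp (measurable_const.prodMk measurable_id : Measurable fun t : E d => (z, t))
    have hν : ((volume : Measure (E d)).withDensity fun t => ‖e (z - t)‖ₑ) univ = 1 := by
      rw [withDensity_apply _ MeasurableSet.univ, Measure.restrict_univ,
        lintegral_sub_left_eq_self (fun t => ‖e t‖ₑ) z, hone]
    have h1 := sq_lintegral_le ((volume : Measure (E d)).withDensity fun t => ‖e (z - t)‖ₑ)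
      hV.enorm.aemeasurable
    rw [hν, one_mul, lintegral_withDensity_eq_lintegral_mul _ hez hV.enorm,
      lintegral_withDensity_eq_lintegral_mul _ hez (hV.enorm.pow_const 2)] at h1
    refine le_trans (pow_le_pow_left' ?_ 2) h1
    refine (enorm_integral_le_lintegral_enorm _).trans (le_of_eq ?_)
    exact lintegral_congr fun t => enorm_smul _ _
  have hm : Measurable fun q : E d × E d => ‖e (q.1 - q.2)‖ₑ * ‖V q.2‖ₑ ^ 2 :=
    hee.mul ((hV.enorm.comp measurable_snd).pow_const 2)
  calc ∫⁻ z, ‖∫ t, e (z - t) • V t‖ₑ ^ 2 ≤ ∫⁻ z, ∫⁻ t, ‖e (z - t)‖ₑ * ‖V t‖ₑ ^ 2 :=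
        lintegral_mono hpt
    _ = ∫⁻ t, ∫⁻ z, ‖e (z - t)‖ₑ * ‖V t‖ₑ ^ 2 :=
        lintegral_lintegral_swap (f := fun z t => ‖e (z - t)‖ₑ * ‖V t‖ₑ ^ 2) hm.aemeasurable
    _ = ∫⁻ t, ‖V t‖ₑ ^ 2 := by
        refine lintegral_congr fun t => ?_
        have hez : Measurable fun z => ‖e (z - t)‖ₑ :=
          hee.comp (measurable_id.prodMk measurable_const : Measurable fun z : E d => (z, t))
        rw [lintegral_mul_const _ hez, lintegral_sub_right_eq_self (fun z => ‖e z‖ₑ) t,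
          hone, one_mul]

/-- A segment in T is compact, hence at positive distance from the complement, so the mollified
gradient formula eventually holds on all of it. The threshold depends on the segment. -/
theorem closedBall_subset_of_segment {d : ℕ} {T : Set (E d)} (hT : IsOpen T) {x y : E d}
    (hs : segment ℝ y x ⊆ T) {r : ℕ → ℝ} (hr : Tendsto r atTop (𝓝 0)) :
    ∀ᶠ n in atTop, ∀ w ∈ segment ℝ y x, Metric.closedBall w (r n) ⊆ T := by
  have hc : IsCompact (segment ℝ y x) := by
    rw [segment_eq_image']
    exact isCompact_Icc.image (by fun_prop)
  obtain ⟨δ, hδ, hδT⟩ := hc.exists_cthickening_subset_open hT hs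
  filter_upwards [hr.eventually_le_const hδ] with n hn w hw
  exact (Metric.closedBall_subset_closedBall hn).trans
    ((Metric.closedBall_subset_cthickening hw δ).trans hδT)

theorem add_smul_sub_mem_segment {d : ℕ} (x y : E d) {s : ℝ} (hs : s ∈ Ioo (0 : ℝ) 1) :
    y + s • (x - y) ∈ segment ℝ y x := by
  rw [segment_eq_image']
  exact ⟨s, Ioo_subset_Icc_self hs, rfl⟩

/-- The Poincaré inequality on a set `Y` all points of which are seen from all points of `B`. -/
theorem H1.exists_const_lintegral_sub_le {d : ℕ} {T Y B : Set (E d)} (hT : IsOpen T)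
    {u : L2 T × L2V T} (hu : u ∈ H1 T) (hYT : Y ⊆ T) (hY : MeasurableSet Y)
    (hB : MeasurableSet B) (hB0 : volume B ≠ 0) (hB1 : volume B ≠ ⊤) {h : ℝ}
    (hdist : ∀ x ∈ Y, ∀ y ∈ B, dist x y ≤ h) (hseg : ∀ x ∈ Y, ∀ y ∈ B, segment ℝ y x ⊆ T) :
    ∃ m : ℝ, volume B * ∫⁻ x in Y, ‖u.1 x - m‖ₑ ^ 2 ≤ 2 ^ d * (volume Y + volume B) *
      (ENNReal.ofReal h ^ 2 * ∫⁻ x in T, ‖u.2 x‖ₑ ^ 2) := by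
  set U := T.indicator u.1 with hUdef
  set V := T.indicator u.2 with hVdef
  have hUm : Measurable U := (Lp.stronglyMeasurable u.1).measurable.indicator hT.measurableSet
  have hVm : StronglyMeasurable V := (Lp.stronglyMeasurable u.2).indicator hT.measurableSet
  have hU := locallyIntegrable_indicator_Lp hT.measurableSet u.1
  -- The ratio of outer to inner radius stays equal to 2, as required for almost everywhere
  -- convergence of the mollifications.
  let η : ℕ → ContDiffBump (0 : E d) := fun n =>
    ⟨1 / (2 * ((n : ℝ) + 1)), 1 / ((n : ℝ) + 1), by positivity, by
      gcongr; linarith [(Nat.cast_nonneg n : (0 : ℝ) ≤ n)]⟩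
  have hη : Tendsto (fun n => (η n).rOut) atTop (𝓝 0) := tendsto_one_div_add_atTop_nhds_zero_nat
  have hη2 : ∀ᶠ n in atTop, (η n).rOut ≤ 2 * (η n).rIn := Eventually.of_forall fun n => by
    change 1 / ((n : ℝ) + 1) ≤ 2 * (1 / (2 * ((n : ℝ) + 1)))
    field_simp; rfl
  have hae := ContDiffBump.ae_convolution_tendsto_right_of_locallyIntegrable hη hη2 hU
  -- V is ∇u extended by zero. It need not be the gradient of U across ∂T, but the two are compared
  -- only along segments inside T.
  let g : ℕ → E d → ℝ≥0∞ := fun n z =>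
    ENNReal.ofReal h ^ 2 * ‖∫ t, (η n).normed volume (z - t) • V t‖ₑ ^ 2
  have hGm : ∀ n, StronglyMeasurable fun z => ∫ t, (η n).normed volume (z - t) • V t := by
    intro n
    refine StronglyMeasurable.integral_prod_right (f := fun z t =>
      (η n).normed volume (z - t) • V t) ?_
    refine StronglyMeasurable.smul (f := fun q : E d × E d => (η n).normed volume (q.1 - q.2))
      (g := fun q => V q.2) ?_ (hVm.comp_measurable measurable_snd)
    exact (((η n).continuous_normed (μ := volume)).comp
      (by fun_prop : Continuous fun q : E d × E d => q.1 - q.2)).stronglyMeasurable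
  have hg : ∀ n, Measurable (g n) := fun n => ((hGm n).enorm.pow_const 2).const_mul _
  have hV2 : ∫⁻ t, ‖V t‖ₑ ^ 2 = ∫⁻ x in T, ‖u.2 x‖ₑ ^ 2 := by
    rw [← lintegral_indicator hT.measurableSet]
    refine lintegral_congr fun t => ?_
    by_cases ht : t ∈ T <;> simp [hVdef, ht]
  have hI : ∀ n, ∫⁻ z, g n z ≤ ENNReal.ofReal h ^ 2 * ∫⁻ x in T, ‖u.2 x‖ₑ ^ 2 := by
    intro n
    rw [lintegral_const_mul _ ((hGm n).enorm.pow_const 2), ← hV2]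
    exact mul_le_mul_right (lintegral_enorm_convolution_sq_le hVm (η n).continuous_normed
      (lintegral_enorm_normed _)) _
  obtain ⟨m, hm⟩ := XHHO.exists_const_lintegral_sub_le (Y := Y) (B := B) hUm hB0 hB1 hg hI (by
    filter_upwards [ae_restrict_of_ae hae, ae_restrict_mem hY] with x hx hxY
    filter_upwards [ae_restrict_of_ae hae, ae_restrict_mem hB] with y hy hyB
    have hlim : Tendsto (fun n => ‖((η n).normed volume
        ⋆[ContinuousLinearMap.lsmul ℝ ℝ, volume] U) x - ((η n).normed volume
        ⋆[ContinuousLinearMap.lsmul ℝ ℝ, volume] U) y‖ₑ ^ 2) atTop (𝓝 (‖U x - U y‖ₑ ^ 2)) := by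
      simpa only [ENNReal.rpow_two] using ((hx.sub hy).enorm).ennrpow_const 2
    rw [← hlim.liminf_eq]
    refine liminf_le_liminf ?_
    filter_upwards [closedBall_subset_of_segment hT (hseg x hxY y hyB) hη] with n hn
    have hsm : ContDiff ℝ 1 ((η n).normed volume
        ⋆[ContinuousLinearMap.lsmul ℝ ℝ, volume] U) :=
      (η n).hasCompactSupport_normed.contDiff_convolution_left _
        ((η n).contDiff_normed (n := 1)) hU
    refine (enorm_sub_sq_le_lintegral_fderiv hsm x y).trans ?_
    refine setLIntegral_mono ((hg n).comp (by fun_prop)) fun s hs => ?_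
    rw [fderiv_convolution_eq_inner hT hu (η n) (hn _ (add_smul_sub_mem_segment x y hs))]
    change _ ≤ ENNReal.ofReal h ^ 2 * _ ^ 2
    rw [← mul_pow]
    refine pow_le_pow_left' ?_ 2
    rw [mul_comm, ← ofReal_norm, ← ofReal_norm, ← ENNReal.ofReal_mul (norm_nonneg _)]
    refine ENNReal.ofReal_le_ofReal ((norm_inner_le_norm _ _).trans ?_)
    gcongr
    rw [← dist_eq_norm]
    exact hdist x hxY y hyB)
  refine ⟨m, le_trans (le_of_eq ?_) hm⟩
  congr 1
  refine setLIntegral_congr_fun hY fun x hx => ?_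
  simp [hUdef, hYT hx]

/-- The smooth case needs no mollification: the sequence is constant. It serves the trace
inequality, where f has to have pointwise values on ∂T. -/
theorem ContDiff.exists_const_lintegral_sub_le {d : ℕ} {T Y B : Set (E d)} (hT : IsOpen T)
    {f : E d → ℝ} (hf : ContDiff ℝ 1 f) (hY : MeasurableSet Y)
    (hB : MeasurableSet B) (hB0 : volume B ≠ 0) (hB1 : volume B ≠ ⊤) {h : ℝ}
    (hdist : ∀ x ∈ Y, ∀ y ∈ B, dist x y ≤ h) (hseg : ∀ x ∈ Y, ∀ y ∈ B, segment ℝ y x ⊆ T) :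
    ∃ m : ℝ, volume B * ∫⁻ x in Y, ‖f x - m‖ₑ ^ 2 ≤ 2 ^ d * (volume Y + volume B) *
      (ENNReal.ofReal h ^ 2 * ∫⁻ x in T, ‖gradient f x‖ₑ ^ 2) := by
  have hgc : Continuous (gradient f) :=
    (InnerProductSpace.toDual ℝ (E d)).symm.continuous.comp (hf.continuous_fderiv one_ne_zero)
  let g : ℕ → E d → ℝ≥0∞ := fun _ =>
    T.indicator fun z => ENNReal.ofReal h ^ 2 * ‖gradient f z‖ₑ ^ 2
  have hg : ∀ n, Measurable (g n) := fun _ =>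
    ((hgc.enorm.measurable.pow_const 2).const_mul _).indicator hT.measurableSet
  have hI : ∀ n, ∫⁻ z, g n z ≤ ENNReal.ofReal h ^ 2 * ∫⁻ x in T, ‖gradient f x‖ₑ ^ 2 := by
    intro n
    rw [lintegral_indicator hT.measurableSet,
      lintegral_const_mul _ (hgc.enorm.measurable.pow_const 2)]
  refine XHHO.exists_const_lintegral_sub_le hf.continuous.measurable hB0 hB1 hg hI ?_
  filter_upwards [ae_restrict_mem hY] with x hx
  filter_upwards [ae_restrict_mem hB] with y hy
  change _ ≤ liminf (fun _ : ℕ => ∫⁻ s in Ioo (0 : ℝ) 1, g 0 (y + s • (x - y))) atTop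
  rw [liminf_const]
  refine (enorm_sub_sq_le_lintegral_fderiv hf x y).trans ?_
  refine setLIntegral_mono ((hg 0).comp (by fun_prop)) fun s hs => ?_
  have hm : y + s • (x - y) ∈ T := hseg x hx y hy (add_smul_sub_mem_segment x y hs)
  simp only [g, indicator_of_mem hm]
  rw [← mul_pow, mul_comm]
  refine pow_le_pow_left' ((enorm_fderiv_apply_le_gradient _ _ _).trans ?_) 2
  gcongr
  rw [← ofReal_norm, ← dist_eq_norm]
  exact ENNReal.ofReal_le_ofReal (hdist x hx y hy)

/-! ### Linking the pieces by chains -/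

theorem enorm_add_sq_le (a b : ℝ) : ‖a + b‖ₑ ^ 2 ≤ 2 * ‖a‖ₑ ^ 2 + 2 * ‖b‖ₑ ^ 2 := by
  have h : (a + b) ^ 2 ≤ 2 * a ^ 2 + 2 * b ^ 2 := by nlinarith [sq_nonneg (a - b)]
  have e : ∀ x : ℝ, ‖x‖ₑ ^ 2 = ENNReal.ofReal (x ^ 2) := fun x => by
    rw [← ofReal_norm, ← ENNReal.ofReal_pow (norm_nonneg _), Real.norm_eq_abs, sq_abs]
  have e2 : (2 : ℝ≥0∞) = ENNReal.ofReal 2 := by simp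
  rw [e, e, e, e2, ← ENNReal.ofReal_mul (by norm_num), ← ENNReal.ofReal_mul (by norm_num),
    ← ENNReal.ofReal_add (by positivity) (by positivity)]
  exact ENNReal.ofReal_le_ofReal h

/-- If `m` changes by at most `δ` along each link of a relation on `N` points, then it changes by at
most `N * δ` between two points connected by links. -/
theorem edist_le_of_reflTransGen {N : ℕ} {r : Fin N → Fin N → Prop} {m : Fin N → ℝ} {δ : ℝ≥0∞}
    (hr : ∀ a c, r a c → edist (m a) (m c) ≤ δ) {i j : Fin N} (h : Relation.ReflTransGen r i j) :
    edist (m i) (m j) ≤ N * δ := by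
  have hreach : (SimpleGraph.fromRel r).Reachable i j := by
    induction h with
    | refl => exact SimpleGraph.Reachable.refl _
    | @tail b c _ hbc ih =>
      by_cases hne : b = c
      · exact hne ▸ ih
      · exact ih.trans (SimpleGraph.Adj.reachable
          ((SimpleGraph.fromRel_adj r b c).2 ⟨hne, Or.inl hbc⟩))
  have hwalk : ∀ {a c : Fin N} (p : (SimpleGraph.fromRel r).Walk a c),
      edist (m a) (m c) ≤ p.length * δ := by
    intro a c p
    induction p with
    | nil => simp
    | @cons a b c hab p ih =>
      rw [SimpleGraph.Walk.length_cons, Nat.cast_add, Nat.cast_one, add_mul, one_mul, add_comm]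
      refine (edist_triangle _ (m b) _).trans (add_le_add ?_ ih)
      rcases ((SimpleGraph.fromRel_adj r a b).1 hab).2 with h | h
      · exact hr _ _ h
      · exact edist_comm (m a) (m b) ▸ hr _ _ h
  -- A chain may revisit pieces and be arbitrarily long; a path has no repeated vertex, so its
  -- length is less than N.
  obtain ⟨p, hp⟩ := hreach.exists_isPath
  refine (hwalk p).trans ?_
  have := hp.length_lt
  rw [Fintype.card_fin] at this
  gcongr

/-- On a shared set of volume at least b, U is close to both constants, so these differ by at most
(4I/b)^{1/2}. Summing over a path compares every constant with that of one fixed piece. -/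
theorem exists_const_lintegral_sub_le_of_chain {d N : ℕ} {Y : Fin N → Set (E d)}
    {U : E d → ℝ} (hU : Measurable U) {I b : ℝ≥0∞} (hb : b ≠ 0) (hb' : b ≠ ⊤)
    (hchain : ∀ i j, Relation.ReflTransGen
      (fun a c => ∃ B', b ≤ volume B' ∧ B' ⊆ Y a ∩ Y c) i j)
    (hm : ∀ i, ∃ m : ℝ, ∫⁻ x in Y i, ‖U x - m‖ₑ ^ 2 ≤ I) :
    ∃ m : ℝ, ∫⁻ x in ⋃ i, Y i, ‖U x - m‖ₑ ^ 2 ≤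
      N * (2 * I + 2 * (N ^ 2 * (4 * I / b)) * volume (⋃ i, Y i)) := by
  rcases isEmpty_or_nonempty (Fin N) with hN | ⟨⟨i₀⟩⟩
  · exact ⟨0, by simp [iUnion_of_empty]⟩
  choose m hm using hm
  have hdiff : ∀ c : ℝ, Measurable fun x => ‖U x - c‖ₑ ^ 2 := fun c => by fun_prop
  have hstep : ∀ a c, (∃ B', b ≤ volume B' ∧ B' ⊆ Y a ∩ Y c) →
      edist (m a) (m c) ≤ (4 * I / b) ^ (1 / 2 : ℝ) := by
    rintro a c ⟨B', hB', hsub⟩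
    have h1 : ‖m a - m c‖ₑ ^ 2 * b ≤ 4 * I := by
      calc ‖m a - m c‖ₑ ^ 2 * b ≤ ‖m a - m c‖ₑ ^ 2 * volume B' := by gcongr
        _ = ∫⁻ _ in B', ‖m a - m c‖ₑ ^ 2 := by rw [setLIntegral_const]
        _ ≤ ∫⁻ x in B', (2 * ‖U x - m c‖ₑ ^ 2 + 2 * ‖U x - m a‖ₑ ^ 2) := by
            refine lintegral_mono fun x => ?_
            have := enorm_add_sq_le (U x - m c) (-(U x - m a))
            rw [enorm_neg] at this
            refine le_trans (le_of_eq ?_) this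
            congr 2; ring
        _ = 2 * (∫⁻ x in B', ‖U x - m c‖ₑ ^ 2) + 2 * ∫⁻ x in B', ‖U x - m a‖ₑ ^ 2 := by
            rw [lintegral_add_left ((hdiff _).const_mul _), lintegral_const_mul _ (hdiff _),
              lintegral_const_mul _ (hdiff _)]
        _ ≤ 2 * I + 2 * I := by
            gcongr
            · exact (lintegral_mono_set (hsub.trans inter_subset_right)).trans (hm c)
            · exact (lintegral_mono_set (hsub.trans inter_subset_left)).trans (hm a)
        _ = 4 * I := by ring
    have h2 : ‖m a - m c‖ₑ ^ 2 ≤ 4 * I / b := by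
      rwa [ENNReal.le_div_iff_mul_le (Or.inl hb) (Or.inl hb')]
    rw [edist_eq_enorm_sub]
    calc ‖m a - m c‖ₑ = (‖m a - m c‖ₑ ^ 2) ^ (1 / 2 : ℝ) := by
          rw [← ENNReal.rpow_two, ← ENNReal.rpow_mul]; norm_num
      _ ≤ _ := ENNReal.rpow_le_rpow h2 (by norm_num)
  have hall : ∀ i, ‖m i - m i₀‖ₑ ^ 2 ≤ N ^ 2 * (4 * I / b) := by
    intro i
    have h1 := edist_le_of_reflTransGen hstep (hchain i i₀)
    rw [edist_eq_enorm_sub] at h1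
    calc _ ≤ (N * (4 * I / b) ^ (1 / 2 : ℝ)) ^ 2 := pow_le_pow_left' h1 2
      _ = _ := by
        rw [mul_pow, ← ENNReal.rpow_two (_ ^ (1 / 2 : ℝ)), ← ENNReal.rpow_mul]
        norm_num
  refine ⟨m i₀, ?_⟩
  calc ∫⁻ x in ⋃ i, Y i, ‖U x - m i₀‖ₑ ^ 2 ≤ ∑ i, ∫⁻ x in Y i, ‖U x - m i₀‖ₑ ^ 2 := by
        refine (lintegral_iUnion_le _ _).trans ?_
        rw [tsum_fintype]
    _ ≤ ∑ _i : Fin N, (2 * I + 2 * (N ^ 2 * (4 * I / b)) * volume (⋃ i, Y i)) := by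
        refine Finset.sum_le_sum fun i _ => ?_
        calc ∫⁻ x in Y i, ‖U x - m i₀‖ₑ ^ 2
            ≤ ∫⁻ x in Y i, (2 * ‖U x - m i‖ₑ ^ 2 + 2 * (N ^ 2 * (4 * I / b))) := by
              refine lintegral_mono fun x => ?_
              have := enorm_add_sq_le (U x - m i) (m i - m i₀)
              rw [sub_add_sub_cancel] at this
              exact this.trans (by gcongr; exact hall i)
          _ = 2 * (∫⁻ x in Y i, ‖U x - m i‖ₑ ^ 2) +
                2 * (N ^ 2 * (4 * I / b)) * volume (Y i) := by
              rw [lintegral_add_left ((hdiff _).const_mul _), lintegral_const_mul _ (hdiff _),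
                setLIntegral_const]
          _ ≤ _ := by
              gcongr
              · exact hm i
              · exact subset_iUnion Y i
    _ = _ := by rw [Finset.sum_const, Finset.card_univ, Fintype.card_fin, nsmul_eq_mul]

/-! ### Hyperplanes and surface measure -/

/-- The hyperplane with normal `n` and offset `b`. -/
def hyperplane {d : ℕ} (n : E d) (b : ℝ) : Set (E d) := {x | inner ℝ n x = b}

theorem isClosed_hyperplane {d : ℕ} (n : E d) (b : ℝ) : IsClosed (hyperplane n b) :=
  isClosed_eq (by fun_prop) continuous_const

theorem smul_mem_hyperplane {d : ℕ} {n : E d} (hn : ‖n‖ = 1) (b : ℝ) : b • n ∈ hyperplane n b := by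
  change inner ℝ n (b • n) = b
  rw [inner_smul_right, real_inner_self_eq_norm_sq, hn]; simp

theorem hyperplane_eq_range {d : ℕ} {n : E d} (hn : ‖n‖ = 1) (b : ℝ) :
    hyperplane n b = range fun k : (ℝ ∙ n)ᗮ => (k : E d) + b • n := by
  have hp : inner ℝ n (b • n) = b := smul_mem_hyperplane hn b
  ext x
  constructor
  · intro hx
    refine ⟨⟨x - b • n, ?_⟩, by simp⟩
    rw [Submodule.mem_orthogonal_singleton_iff_inner_right, inner_sub_right, hp]
    exact sub_eq_zero.2 hx
  · rintro ⟨k, rfl⟩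
    have hk := Submodule.mem_orthogonal_singleton_iff_inner_right.1 k.2
    change inner ℝ n ((k : E d) + b • n) = b
    rw [inner_add_right, hk, hp, zero_add]

theorem isometry_add_const {d : ℕ} (K : Submodule ℝ (E d)) (p : E d) :
    Isometry fun k : K => (k : E d) + p :=
  (isometry_add_right p).comp isometry_subtype_coe

/-- Translation by b • n is an isometry of n^⊥ onto the hyperplane, and the normalised Hausdorff
measure of dimension d − 1 is the volume on n^⊥. -/
theorem surface_hyperplane_inter {d : ℕ} {n : E d} (hn : ‖n‖ = 1) (b : ℝ) (s : Set (E d)) :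
    surface d (hyperplane n b ∩ s) =
      volume ((fun k : (ℝ ∙ n)ᗮ => (k : E d) + b • n) ⁻¹' s) := by
  have hn0 : n ≠ 0 := by rintro rfl; simp at hn
  have hd : Module.finrank ℝ (ℝ ∙ n)ᗮ = d - 1 := by
    refine Submodule.finrank_add_finrank_orthogonal' ?_
    have h1 : 1 ≤ d := by
      have := Submodule.finrank_le (ℝ ∙ n)
      rwa [finrank_span_singleton hn0, finrank_euclideanSpace, Fintype.card_fin] at this
    rw [finrank_span_singleton hn0, finrank_euclideanSpace, Fintype.card_fin]
    omega
  rw [← InnerProductSpace.euclideanHausdorffMeasure_eq_volume, hd, surface,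
    (isometry_add_const _ _).euclideanHausdorffMeasure_preimage, hyperplane_eq_range hn, inter_comm]

theorem surface_hyperplane_inter_lt_top {d : ℕ} {n : E d} (hn : ‖n‖ = 1) (b : ℝ) {s : Set (E d)}
    (hs : Bornology.IsBounded s) : surface d (hyperplane n b ∩ s) < ⊤ := by
  rw [surface_hyperplane_inter hn]
  exact ((isometry_add_const _ _).antilipschitz.isBounded_preimage hs).measure_lt_top

theorem hyperplane_eq_of_subset {d : ℕ} {n n' : E d} (hn : ‖n‖ = 1) (hn' : ‖n'‖ = 1) {b b' : ℝ}
    (h : hyperplane n b ⊆ hyperplane n' b') : hyperplane n b = hyperplane n' b' := by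
  have hp' : inner ℝ n' (b • n) = b' := h (smul_mem_hyperplane hn b)
  have hmem : n' ∈ (ℝ ∙ n)ᗮᗮ := by
    rw [Submodule.mem_orthogonal]
    intro k hk
    have h1 : inner ℝ n' (k + b • n) = b' := h (by
      rw [hyperplane_eq_range hn]; exact ⟨⟨k, hk⟩, rfl⟩)
    rw [inner_add_right, hp'] at h1
    rw [real_inner_comm]; linarith
  rw [Submodule.orthogonal_orthogonal, Submodule.mem_span_singleton] at hmem
  obtain ⟨a, rfl⟩ := hmem
  have ha : a ≠ 0 := by rintro rfl; simp at hn'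
  refine h.antisymm fun x hx => ?_
  have hx' : inner ℝ (a • n) x = b' := hx
  rw [← hp', real_inner_smul_left, real_inner_smul_left] at hx'
  have := mul_left_cancel₀ ha hx'
  rw [inner_smul_right, real_inner_self_eq_norm_sq, hn] at this
  change inner ℝ n x = b
  simpa using this

/-- In the chart n^⊥ the intersection is empty or an affine subspace. The latter is proper, since
one hyperplane inside another equals it. -/
theorem surface_hyperplane_inter_hyperplane {d : ℕ} {n n' : E d} (hn : ‖n‖ = 1) (hn' : ‖n'‖ = 1)
    {b b' : ℝ} (h : hyperplane n b ≠ hyperplane n' b') :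
    surface d (hyperplane n b ∩ hyperplane n' b') = 0 := by
  rw [surface_hyperplane_inter hn]
  set S := (fun k : (ℝ ∙ n)ᗮ => (k : E d) + b • n) ⁻¹' hyperplane n' b' with hS
  rcases S.eq_empty_or_nonempty with h0 | ⟨k₀, hk₀⟩
  · simp [h0]
  let l : (ℝ ∙ n)ᗮ →ₗ[ℝ] ℝ := (innerₗ (E d) n').comp (Submodule.subtype _)
  have hmem : ∀ k, k ∈ S ↔ l (k - k₀) = 0 := by
    intro k
    have h0 : inner ℝ n' ((k₀ : E d) + b • n) = b' := hk₀
    change inner ℝ n' ((k : E d) + b • n) = b' ↔ inner ℝ n' ((k : E d) - k₀) = 0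
    rw [← h0, inner_add_right, inner_add_right, inner_sub_right, add_left_inj, sub_eq_zero]
  have hSa : S = (AffineSubspace.mk' k₀ (LinearMap.ker l) : Set (ℝ ∙ n)ᗮ) := by
    ext k
    rw [hmem, SetLike.mem_coe, AffineSubspace.mem_mk', LinearMap.mem_ker]; rfl
  rw [hSa]
  refine Measure.addHaar_affineSubspace _ _ fun htop => h ?_
  refine hyperplane_eq_of_subset hn hn' ?_
  rw [hyperplane_eq_range hn]
  rintro _ ⟨k, rfl⟩
  have : k ∈ S := by rw [hSa, htop]; trivial
  exact this

/-! ### Cones and the trace inequality -/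

/-- The open cone with base `A` and apex `c`, for `A` a subset of a hyperplane with normal `n` at
signed distance `D` of `c`. -/
def openCone {d : ℕ} (n c : E d) (D : ℝ) (A : Set (E d)) : Set (E d) :=
  {z | inner ℝ n (z - c) / D ∈ Ioo (0 : ℝ) 1 ∧ c + (inner ℝ n (z - c) / D)⁻¹ • (z - c) ∈ A}

theorem measurableSet_openCone {d : ℕ} (n c : E d) (D : ℝ) {A : Set (E d)} (hA : MeasurableSet A) :
    MeasurableSet (openCone n c D A) := by
  have h1 : Measurable fun z : E d => inner ℝ n (z - c) / D :=
    (by fun_prop : Continuous fun z : E d => inner ℝ n (z - c) / D).measurable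
  refine (h1 measurableSet_Ioo).inter ?_
  have h2 : Measurable fun z : E d => c + (inner ℝ n (z - c) / D)⁻¹ • (z - c) :=
    measurable_const.add (h1.inv.smul (measurable_id.sub_const c))
  exact h2 hA

theorem inner_smul_sub_div {d : ℕ} {n c x : E d} {b : ℝ} (hD : b - inner ℝ n c ≠ 0)
    (hx : x ∈ hyperplane n b) (s : ℝ) :
    inner ℝ n (c + s • (x - c) - c) / (b - inner ℝ n c) = s := by
  have hx' : inner ℝ n x = b := hx
  rw [add_sub_cancel_left, inner_smul_right, inner_sub_right, hx', mul_div_cancel_right₀ _ hD]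

theorem mem_openCone {d : ℕ} {n c x : E d} {b : ℝ} (hD : b - inner ℝ n c ≠ 0) {A : Set (E d)}
    (hx : x ∈ hyperplane n b) (hxA : x ∈ A) {s : ℝ} (hs : s ∈ Ioo (0 : ℝ) 1) :
    c + s • (x - c) ∈ openCone n c (b - inner ℝ n c) A := by
  refine ⟨by rwa [inner_smul_sub_div hD hx], ?_⟩
  rw [inner_smul_sub_div hD hx, add_sub_cancel_left, smul_smul, inv_mul_cancel₀ hs.1.ne',
    one_smul, add_sub_cancel]
  exact hxA

theorem exists_of_mem_openCone {d : ℕ} {n c z : E d} {D : ℝ} {A : Set (E d)}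
    (hz : z ∈ openCone n c D A) : ∃ x ∈ A, ∃ s ∈ Ioo (0 : ℝ) 1, z = c + s • (x - c) := by
  refine ⟨_, hz.2, _, hz.1, ?_⟩
  rw [add_sub_cancel_left, smul_smul, mul_inv_cancel₀ hz.1.1.ne', one_smul, add_sub_cancel]

/-- In the coordinates z = c + s(x − c), the slice at s is a homothetic copy of the base, with
surface factor s^(d−1), and slices are spaced by |D| ds. -/
theorem lintegral_cone_le {d : ℕ} {n : E d} (hn : ‖n‖ = 1) {b : ℝ} {c : E d}
    (hD : b - inner ℝ n c ≠ 0) {A : Set (E d)} (hA : MeasurableSet A) (hAH : A ⊆ hyperplane n b)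
    (hAb : Bornology.IsBounded A) {g : E d → ℝ≥0∞} (hg : Measurable g) :
    ENNReal.ofReal |b - inner ℝ n c| * ∫⁻ x in A, (∫⁻ s in Ioo (0 : ℝ) 1,
        ENNReal.ofReal (s ^ (d - 1)) * g (c + s • (x - c))) ∂(surface d) ≤
      ∫⁻ z in openCone n c (b - inner ℝ n c) A, g z := by
  set D := b - inner ℝ n c with hDdef
  set C := openCone n c D A with hC
  have hAfin : surface d A < ⊤ := by
    have := surface_hyperplane_inter_lt_top hn b hAb
    rwa [inter_eq_right.2 hAH] at this
  have : IsFiniteMeasure ((surface d).restrict A) := ⟨by simpa using hAfin⟩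
  have hw : Measurable fun s : ℝ => ENNReal.ofReal (s ^ (d - 1)) :=
    (measurable_id.pow_const _).ennreal_ofReal
  set κ := (volume.restrict (Ioo (0 : ℝ) 1)).withDensity fun s => ENNReal.ofReal (s ^ (d - 1))
    with hκ
  let Φ : ℝ × E d → E d := fun q => c + q.1 • (q.2 - c)
  have hΦ : Measurable Φ := by fun_prop
  set v := D • n with hv
  have hnv : ‖v‖ₑ = ENNReal.ofReal |D| := by
    rw [hv, enorm_smul, ← ofReal_norm n, hn, ENNReal.ofReal_one, mul_one, ← ofReal_norm,
      Real.norm_eq_abs]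
  have hn0 : n ≠ 0 := by rintro rfl; simp at hn
  have hv0 : v ≠ 0 := smul_ne_zero hD hn0
  -- It suffices to compare the image of |D| s^(d−1) ds dσ with Lebesgue measure, which is sliced by
  -- the hyperplanes orthogonal to v = D n.
  have hle : ENNReal.ofReal |D| • (κ.prod ((surface d).restrict A)).map Φ ≤
      (volume : Measure (E d)).restrict C := by
    refine Measure.le_iff.2 fun t ht => ?_
    have hCm : MeasurableSet C := measurableSet_openCone n c D hA
    rw [Measure.smul_apply, smul_eq_mul, Measure.map_apply hΦ ht, Measure.prod_apply (hΦ ht),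
      Measure.restrict_apply ht, ← InnerProductSpace.euclideanHausdorffMeasure_eq_volume,
      EuclideanGeometry.euclideanHausdorffMeasure_eq_lintegral c hv0 (ht.inter hCm), hnv]
    refine mul_le_mul_right ?_ _
    rw [hκ, lintegral_withDensity_eq_lintegral_mul _ hw (measurable_measure_prodMk_left (hΦ ht))]
    refine le_trans ?_ (setLIntegral_le_lintegral (Ioo (0 : ℝ) 1) _)
    refine setLIntegral_mono' measurableSet_Ioo fun s hs => ?_
    have hs0 : s ≠ 0 := hs.1.ne'
    rw [finrank_euclideanSpace, Fintype.card_fin, Pi.mul_apply,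
      Measure.restrict_apply (measurable_prodMk_left (hΦ ht))]
    have himg := euclideanHausdorffMeasure_homothety_image (d - 1) c hs0
      (Prod.mk s ⁻¹' (Φ ⁻¹' t) ∩ A)
    have hsn : (ENNReal.ofReal (s ^ (d - 1))) = ((‖s‖₊ ^ (d - 1) : NNReal) : ℝ≥0∞) := by
      rw [ENNReal.ofReal_pow hs.1.le, ENNReal.coe_pow, ← Real.enorm_eq_ofReal hs.1.le]; rfl
    rw [hsn, surface, ← smul_eq_mul, ← ENNReal.smul_def, ← himg]
    refine measure_mono ?_
    rintro _ ⟨x, ⟨hxt, hxA⟩, rfl⟩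
    have hhom : AffineMap.homothety c s x = c + s • (x - c) := by
      rw [AffineMap.homothety_apply, vsub_eq_sub, vadd_eq_add, add_comm]
    rw [hhom]
    refine ⟨⟨hxt, mem_openCone hD (hAH hxA) hxA hs⟩, ?_⟩
    rw [SetLike.mem_coe, AffineSubspace.mem_mk',
      Submodule.mem_orthogonal_singleton_iff_inner_right, vsub_eq_sub, vadd_eq_add]
    have h1 : inner ℝ n (c + s • (x - c) - c) = s * D :=
      (div_eq_iff hD).1 (inner_smul_sub_div hD (hAH hxA) s)
    have h2 : c + s • (x - c) - (s • v + c) = (c + s • (x - c) - c) - s • v := by abel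
    rw [h2, inner_sub_right, hv, real_inner_smul_left, h1, smul_smul, real_inner_smul_left,
      inner_smul_right, real_inner_self_eq_norm_sq, hn]
    ring
  calc ENNReal.ofReal |D| * ∫⁻ x in A, (∫⁻ s in Ioo (0 : ℝ) 1,
        ENNReal.ofReal (s ^ (d - 1)) * g (c + s • (x - c))) ∂(surface d)
      = ∫⁻ z, g z ∂(ENNReal.ofReal |D| • (κ.prod ((surface d).restrict A)).map Φ) := by
        rw [lintegral_smul_measure, lintegral_map hg hΦ, smul_eq_mul,
          lintegral_prod_symm (fun q => g (Φ q)) (hg.comp hΦ).aemeasurable]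
        congr 1
        refine lintegral_congr fun x => ?_
        rw [hκ, lintegral_withDensity_eq_lintegral_mul _ hw
          (f := fun s => ENNReal.ofReal (s ^ (d - 1))) (g := fun s => g (Φ (s, x)))
          (hg.comp (hΦ.comp (measurable_id.prodMk measurable_const)))]
        rfl
    _ ≤ ∫⁻ z in C, g z := lintegral_mono' hle le_rfl

theorem continuous_gradient {d : ℕ} {f : E d → ℝ} (hf : ContDiff ℝ 1 f) :
    Continuous (gradient f) :=
  (InnerProductSpace.toDual ℝ (E d)).symm.continuous.comp (hf.continuous_fderiv one_ne_zero)

theorem enorm_sq_eq_ofReal (x : ℝ) : ‖x‖ₑ ^ 2 = ENNReal.ofReal (x ^ 2) := by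
  rw [← ofReal_norm, ← ENNReal.ofReal_pow (norm_nonneg _), Real.norm_eq_abs, sq_abs]

/-- Integrate the derivative of s^d f(c + s(x − c))² over (0, 1). The weight removes the value at
the apex and leaves the cone Jacobian s^(d−1); the cross term is split by 2ab ≤ a² + b². -/
theorem enorm_sq_le_lintegral_ray {d : ℕ} (hd : 1 ≤ d) {f : E d → ℝ} (hf : ContDiff ℝ 1 f)
    {x c : E d} {h : ℝ} (hx : ‖x - c‖ ≤ h) :
    ‖f x‖ₑ ^ 2 ≤ ∫⁻ s in Ioo (0 : ℝ) 1, ENNReal.ofReal (s ^ (d - 1)) *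
      ENNReal.ofReal ((d + 1) * f (c + s • (x - c)) ^ 2 +
        h ^ 2 * ‖gradient f (c + s • (x - c))‖ ^ 2) := by
  set z : ℝ → E d := fun s => c + s • (x - c) with hz
  have hzc : Continuous z := by fun_prop
  have hfz : Continuous fun s => f (z s) := hf.continuous.comp hzc
  have hgz : Continuous fun s => gradient f (z s) := (continuous_gradient hf).comp hzc
  have hdz : Continuous fun s => fderiv ℝ f (z s) (x - c) :=
    ((hf.continuous_fderiv one_ne_zero).comp hzc).clm_apply continuous_const
  let F' : ℝ → ℝ := fun s => d * s ^ (d - 1) * f (z s) ^ 2 +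
    s ^ d * (2 * f (z s) * fderiv ℝ f (z s) (x - c))
  let G : ℝ → ℝ := fun s => s ^ (d - 1) *
    ((d + 1) * f (z s) ^ 2 + h ^ 2 * ‖gradient f (z s)‖ ^ 2)
  have hF'c : Continuous F' := by fun_prop
  have hGc : Continuous G := by fun_prop
  have hF : ∀ s : ℝ, HasDerivAt (fun s : ℝ => s ^ d * f (z s) ^ 2) (F' s) s := by
    intro s
    have h1 : HasDerivAt z (x - c) s :=
      (((hasDerivAt_id s).smul_const (x - c)).const_add c).congr_deriv (one_smul _ _)
    have h2 := (hf.differentiable one_ne_zero (z s)).hasFDerivAt.comp_hasDerivAt s h1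
    refine ((hasDerivAt_pow d s).mul (h2.pow 2)).congr_deriv ?_
    simp [F']
  have hi := intervalIntegral.integral_eq_sub_of_hasDerivAt (a := 0) (b := 1)
    (fun s _ => hF s) (hF'c.intervalIntegrable _ _)
  rw [intervalIntegral.integral_of_le zero_le_one, integral_Ioc_eq_integral_Ioo] at hi
  have hfx : f x ^ 2 = ∫ s in Ioo (0 : ℝ) 1, F' s := by
    rw [hi]
    simp [hz, show d ≠ 0 by omega]
  have hGi : IntegrableOn G (Ioo 0 1) :=
    (hGc.integrableOn_Icc).mono_set Ioo_subset_Icc_self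
  have hG0 : ∀ s ∈ Ioo (0 : ℝ) 1, 0 ≤ G s := fun s hs => by
    have := hs.1.le
    positivity
  have hle : ∀ s ∈ Ioo (0 : ℝ) 1, F' s ≤ G s := by
    intro s hs
    have hs1 : s ^ d = s ^ (d - 1) * s := by rw [← pow_succ]; congr 1; omega
    have hp : 0 ≤ s ^ (d - 1) := pow_nonneg hs.1.le _
    have hb : |fderiv ℝ f (z s) (x - c)| ≤ h * ‖gradient f (z s)‖ := by
      rw [← inner_gradient_left, mul_comm]
      exact (abs_real_inner_le_norm _ _).trans (by gcongr)
    have hb2 : fderiv ℝ f (z s) (x - c) ^ 2 ≤ (h * ‖gradient f (z s)‖) ^ 2 :=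
      sq_le_sq' (by linarith [neg_abs_le (fderiv ℝ f (z s) (x - c))]) ((le_abs_self _).trans hb)
    have hmain : s * (2 * f (z s) * fderiv ℝ f (z s) (x - c)) ≤
        f (z s) ^ 2 + h ^ 2 * ‖gradient f (z s)‖ ^ 2 := by
      have h1 := sq_nonneg (f (z s) - s * fderiv ℝ f (z s) (x - c))
      have h2 : s ^ 2 * fderiv ℝ f (z s) (x - c) ^ 2 ≤ 1 * fderiv ℝ f (z s) (x - c) ^ 2 := by
        gcongr
        exact pow_le_one₀ hs.1.le hs.2.le
      nlinarith
    calc F' s = s ^ (d - 1) * (d * f (z s) ^ 2 +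
          s * (2 * f (z s) * fderiv ℝ f (z s) (x - c))) := by simp only [F', hs1]; ring
      _ ≤ s ^ (d - 1) * (d * f (z s) ^ 2 +
          (f (z s) ^ 2 + h ^ 2 * ‖gradient f (z s)‖ ^ 2)) := by gcongr
      _ = G s := by simp only [G]; ring
  calc ‖f x‖ₑ ^ 2 = ENNReal.ofReal (∫ s in Ioo (0 : ℝ) 1, F' s) := by
        rw [enorm_sq_eq_ofReal, hfx]
    _ ≤ ENNReal.ofReal (∫ s in Ioo (0 : ℝ) 1, G s) := by
        refine ENNReal.ofReal_le_ofReal (setIntegral_mono_on ?_ hGi measurableSet_Ioo hle)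
        exact (hF'c.integrableOn_Icc).mono_set Ioo_subset_Icc_self
    _ = ∫⁻ s in Ioo (0 : ℝ) 1, ENNReal.ofReal (G s) :=
        ofReal_integral_eq_lintegral_ofReal hGi
          ((ae_restrict_mem measurableSet_Ioo).mono hG0)
    _ = _ := by
        refine setLIntegral_congr_fun measurableSet_Ioo fun s hs => ?_
        exact ENNReal.ofReal_mul (pow_nonneg hs.1.le _)

/-- The trace inequality on a part `Z` of finitely many hyperplanes which is outside of an open set
`Y` and which is seen inside of `Y` from a point whose distance to these hyperplanes is at least
`ρ`. -/
theorem lintegral_surface_le_of_cone {d : ℕ} (hd : 1 ≤ d) {Y Z : Set (E d)}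
    (hZ : MeasurableSet Z) {ι : Type*} [Finite ι] {n : ι → E d} {b : ι → ℝ}
    (hn : ∀ i, ‖n i‖ = 1)
    (hinj : ∀ i j, i ≠ j → hyperplane (n i) (b i) ≠ hyperplane (n j) (b j))
    (hZH : Z ⊆ ⋃ i, hyperplane (n i) (b i)) {c : E d} {ρ h : ℝ} (hρ : 0 < ρ)
    (hρZ : ∀ i, ∀ x ∈ Z, x ∈ hyperplane (n i) (b i) →
      (∀ j ≠ i, x ∉ hyperplane (n j) (b j)) → ρ ≤ |b i - inner ℝ (n i) c|)
    (hZh : ∀ x ∈ Z, ‖x - c‖ ≤ h) (hZY : Disjoint Z Y)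
    (hcone : ∀ x ∈ Z, ∀ s ∈ Ioo (0 : ℝ) 1, c + s • (x - c) ∈ Y)
    {f : E d → ℝ} (hf : ContDiff ℝ 1 f) :
    ENNReal.ofReal ρ * ∫⁻ x in Z, ‖f x‖ₑ ^ 2 ∂(surface d) ≤
      ∫⁻ z in Y, ENNReal.ofReal ((d + 1) * f z ^ 2 + h ^ 2 * ‖gradient f z‖ ^ 2) := by
  cases nonempty_fintype ι
  set g : E d → ℝ≥0∞ := fun z =>
    ENNReal.ofReal ((d + 1) * f z ^ 2 + h ^ 2 * ‖gradient f z‖ ^ 2) with hg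
  have hgm : Measurable g := by
    have := hf.continuous
    have := continuous_gradient hf
    exact (ENNReal.continuous_ofReal.comp (by fun_prop)).measurable
  let H : ι → Set (E d) := fun i => hyperplane (n i) (b i)
  have hHc : ∀ i, IsClosed (H i) := fun i => isClosed_hyperplane _ _
  -- Points on exactly one of the hyperplanes; the others form a null set.
  let A : ι → Set (E d) := fun i => (Z ∩ H i) \ ⋃ j ∈ ({j | j ≠ i} : Set ι), H j
  have hAm : ∀ i, MeasurableSet (A i) := fun i =>
    (hZ.inter (hHc i).measurableSet).diff
      (MeasurableSet.biUnion (to_countable _) fun j _ => (hHc j).measurableSet)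
  have hAZ : ∀ i, A i ⊆ Z := fun i x hx => hx.1.1
  have hAH : ∀ i, A i ⊆ H i := fun i x hx => hx.1.2
  have hAn : ∀ i, ∀ x ∈ A i, ∀ j ≠ i, x ∉ H j := fun i x hx j hj hxj =>
    hx.2 (mem_biUnion (x := j) hj hxj)
  have hZb : Bornology.IsBounded Z := Metric.isBounded_closedBall (x := c) (r := h) |>.subset
    fun x hx => by rw [Metric.mem_closedBall, dist_eq_norm]; exact hZh x hx
  have hpiece : ∀ i, ENNReal.ofReal ρ * ∫⁻ x in A i, ‖f x‖ₑ ^ 2 ∂(surface d) ≤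
      ∫⁻ z in openCone (n i) c (b i - inner ℝ (n i) c) (A i), g z := by
    intro i
    rcases (A i).eq_empty_or_nonempty with h0 | ⟨x₀, hx₀⟩
    · simp [h0]
    have hρi : ρ ≤ |b i - inner ℝ (n i) c| :=
      hρZ i x₀ (hAZ i hx₀) (hAH i hx₀) (hAn i x₀ hx₀)
    have hD : b i - inner ℝ (n i) c ≠ 0 := abs_pos.1 (hρ.trans_le hρi)
    refine le_trans ?_ (lintegral_cone_le (hn i) hD (hAm i) (hAH i) (hZb.subset (hAZ i)) hgm)
    refine mul_le_mul' (ENNReal.ofReal_le_ofReal hρi) ?_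
    exact setLIntegral_mono' (hAm i) fun x hx =>
      enorm_sq_le_lintegral_ray hd hf (hZh x (hAZ i hx))
  -- If two cones meet, a ray from c carries a point of Z for each. When these differ, the nearer
  -- one lies inside the segment to the farther one, hence in Y, which Z avoids. When they agree,
  -- the point lies on two hyperplanes.
  have hdisj : Pairwise (Function.onFun Disjoint
      fun i => openCone (n i) c (b i - inner ℝ (n i) c) (A i)) := by
    intro i j hij
    refine Set.disjoint_left.2 fun z hzi hzj => ?_
    obtain ⟨x, hx, s, hs, hzx⟩ := exists_of_mem_openCone hzi
    obtain ⟨x', hx', s', hs', hzx'⟩ := exists_of_mem_openCone hzj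
    have haux : ∀ {p q : E d} {s t : ℝ}, p ∈ Z → q ∈ Z → s ∈ Ioo (0 : ℝ) 1 → t ∈ Ioo (0 : ℝ) 1 →
        s < t → c + s • (p - c) = c + t • (q - c) → False := by
      intro p q s t hp hq hs ht hst heq
      have h1 : q = c + (s / t) • (p - c) := by
        have h2 : s • (p - c) = t • (q - c) := add_left_cancel heq
        rw [div_eq_inv_mul, mul_smul, h2, smul_smul, inv_mul_cancel₀ ht.1.ne', one_smul,
          add_sub_cancel]
      refine Set.disjoint_left.1 hZY hq ?_
      rw [h1]
      exact hcone p hp _ ⟨div_pos hs.1 ht.1, (div_lt_one ht.1).2 hst⟩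
    have heq := hzx.symm.trans hzx'
    rcases lt_trichotomy s s' with hlt | rfl | hlt
    · exact haux (hAZ i hx) (hAZ j hx') hs hs' hlt heq
    · have h2 : s • (x - c) = s • (x' - c) := add_left_cancel heq
      have h3 : x = x' := sub_left_injective (smul_right_injective _ hs.1.ne' h2)
      exact hAn i x hx j hij.symm (h3 ▸ hAH j hx')
    · exact haux (hAZ j hx') (hAZ i hx) hs' hs hlt heq.symm
  have hnull : surface d (⋃ i, ⋃ j ∈ ({j | j ≠ i} : Set ι), H i ∩ H j) = 0 := by
    refine measure_iUnion_null fun i => ?_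
    refine (measure_biUnion_null_iff (to_countable _)).2 fun j hj => ?_
    exact surface_hyperplane_inter_hyperplane (hn i) (hn j) (hinj i j (Ne.symm hj))
  have hcover : Z ⊆ (⋃ i, A i) ∪ ⋃ i, ⋃ j ∈ ({j | j ≠ i} : Set ι), H i ∩ H j := by
    intro x hx
    obtain ⟨i, hi⟩ := mem_iUnion.1 (hZH hx)
    by_cases h : x ∈ ⋃ j ∈ ({j | j ≠ i} : Set ι), H j
    · obtain ⟨j, hj, hxj⟩ := mem_iUnion₂.1 h
      exact Or.inr (mem_iUnion.2 ⟨i, mem_iUnion₂.2 ⟨j, hj, hi, hxj⟩⟩)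
    · exact Or.inl (mem_iUnion.2 ⟨i, ⟨hx, hi⟩, h⟩)
  calc ENNReal.ofReal ρ * ∫⁻ x in Z, ‖f x‖ₑ ^ 2 ∂(surface d)
      ≤ ENNReal.ofReal ρ * ∑ i, ∫⁻ x in A i, ‖f x‖ₑ ^ 2 ∂(surface d) := by
        refine mul_le_mul_right ?_ _
        refine ((lintegral_mono_set hcover).trans (lintegral_union_le _ _ _)).trans ?_
        rw [setLIntegral_measure_zero _ _ hnull, add_zero]
        exact (lintegral_iUnion_le _ _).trans (by rw [tsum_fintype])
    _ = ∑ i, ENNReal.ofReal ρ * ∫⁻ x in A i, ‖f x‖ₑ ^ 2 ∂(surface d) := Finset.mul_sum _ _ _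
    _ ≤ ∑ i, ∫⁻ z in openCone (n i) c (b i - inner ℝ (n i) c) (A i), g z :=
        Finset.sum_le_sum fun i _ => hpiece i
    _ = ∫⁻ z in ⋃ i, openCone (n i) c (b i - inner ℝ (n i) c) (A i), g z := by
        rw [lintegral_iUnion (fun i => measurableSet_openCone _ _ _ (hAm i)) hdisj, tsum_fintype]
    _ ≤ ∫⁻ z in Y, g z := by
        refine lintegral_mono_set (iUnion_subset fun i z hz => ?_)
        obtain ⟨x, hx, s, hs, rfl⟩ := exists_of_mem_openCone hz
        exact hcone x (hAZ i hx) s hs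

/-! ### Boundaries of polytopes and of star-shaped sets -/

namespace IsPolytope

variable {d : ℕ} {T : Set (E d)}

theorem isOpen (hT : IsPolytope T) : IsOpen T := by
  obtain ⟨-, S, -, rfl⟩ := hT
  exact isOpen_interior

theorem nonempty (hT : IsPolytope T) : T.Nonempty := hT.1.nonempty

theorem isCompact_biUnion_simplex {S : Set (Affine.Simplex ℝ (E d) d)} (hS : S.Finite) :
    IsCompact (⋃ s ∈ S, convexHull ℝ (range s.points)) :=
  hS.isCompact_biUnion fun s _ => (finite_range s.points).isCompact_convexHull ℝ

theorem isBounded (hT : IsPolytope T) : Bornology.IsBounded T := by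
  obtain ⟨-, S, hS, rfl⟩ := hT
  exact (isCompact_biUnion_simplex hS).isBounded.subset interior_subset

/-- This excludes cracks: near a boundary point, the complement of T cannot be contained in a
hyperplane. -/
theorem interior_closure_subset (hT : IsPolytope T) : interior (closure T) ⊆ T := by
  obtain ⟨-, S, hS, rfl⟩ := hT
  exact interior_mono (closure_minimal interior_subset (isCompact_biUnion_simplex hS).isClosed)

end IsPolytope

theorem exists_hyperplane_of_affineMap {d : ℕ} (a : E d →ᵃ[ℝ] ℝ) {p q : E d} (hpq : a p ≠ a q) :
    ∃ (n : E d) (b : ℝ), ‖n‖ = 1 ∧ {x | a x = 0} ⊆ hyperplane n b := by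
  let n₀ : E d := (InnerProductSpace.toDual ℝ (E d)).symm (LinearMap.toContinuousLinearMap a.linear)
  have hn₀ : ∀ x, inner ℝ n₀ x = a.linear x := fun x => InnerProductSpace.toDual_symm_apply
  have ha : ∀ x, a x = inner ℝ n₀ x + a 0 := fun x => by
    rw [hn₀]; exact congrFun a.decomp x
  have hne : n₀ ≠ 0 := fun h => hpq (by rw [ha, ha q, h, inner_zero_left, inner_zero_left])
  have hne' : ‖n₀‖ ≠ 0 := norm_ne_zero_iff.2 hne
  refine ⟨‖n₀‖⁻¹ • n₀, ‖n₀‖⁻¹ * (-a 0), ?_, fun x hx => ?_⟩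
  · rw [norm_smul, norm_inv, norm_norm, inv_mul_cancel₀ hne']
  · have hx' : a x = 0 := hx
    rw [ha] at hx'
    change inner ℝ (‖n₀‖⁻¹ • n₀) x = _
    rw [real_inner_smul_left, eq_neg_of_add_eq_zero_left hx']

/-- The boundary of a polytope is contained in the union of finitely many distinct hyperplanes. -/
theorem IsPolytope.exists_hyperplanes {d : ℕ} (hd : 1 ≤ d) {T : Set (E d)} (hT : IsPolytope T) :
    ∃ (ι : Type) (_ : Finite ι) (n : ι → E d) (b : ι → ℝ), (∀ i, ‖n i‖ = 1) ∧
      (∀ i j, i ≠ j → hyperplane (n i) (b i) ≠ hyperplane (n j) (b j)) ∧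
      frontier T ⊆ ⋃ i, hyperplane (n i) (b i) := by
  have hopen := hT.isOpen
  obtain ⟨-, S, hS, hTS⟩ := hT
  have hfr : Module.finrank ℝ (E d) = d := by simp
  let B : Affine.Simplex ℝ (E d) d → AffineBasis (Fin (d + 1)) ℝ (E d) := fun s =>
    ⟨s.points, s.independent, s.span_eq_top hfr⟩
  have hH : ∀ (s : Affine.Simplex ℝ (E d) d) (i : Fin (d + 1)), ∃ (n : E d) (b : ℝ), ‖n‖ = 1 ∧
      {x | (B s).coord i x = 0} ⊆ hyperplane n b := by
    intro s i
    have : Nontrivial (Fin (d + 1)) := Fin.nontrivial_iff_two_le.2 (by omega)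
    obtain ⟨j, hj⟩ := exists_ne i
    refine exists_hyperplane_of_affineMap ((B s).coord i) (p := B s i) (q := B s j) ?_
    rw [AffineBasis.coord_apply_eq, AffineBasis.coord_apply_ne _ hj.symm]
    exact one_ne_zero
  choose n b hn hsub using hH
  -- Indexing by the hyperplanes as sets removes repetitions between simplices.
  set 𝓗 : Set (Set (E d)) := (fun q : Affine.Simplex ℝ (E d) d × Fin (d + 1) =>
    hyperplane (n q.1 q.2) (b q.1 q.2)) '' (S ×ˢ univ) with h𝓗
  have hfin : 𝓗.Finite := (hS.prod finite_univ).image _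
  have := hfin.to_subtype
  obtain ⟨m, ⟨e⟩⟩ := Finite.exists_equiv_fin 𝓗
  have hrep : ∀ i : Fin m, ∃ (n : E d) (b : ℝ), ‖n‖ = 1 ∧ hyperplane n b = (e.symm i : Set (E d)) := by
    intro i
    obtain ⟨q, -, hq⟩ := (e.symm i).2
    exact ⟨_, _, hn q.1 q.2, hq⟩
  choose n' b' hn' heq using hrep
  refine ⟨Fin m, inferInstance, n', b', hn', fun i j hij h => hij ?_, fun x hx => ?_⟩
  · rw [heq, heq] at h
    exact e.symm.injective (Subtype.ext h)
  · rw [hopen.frontier_eq] at hx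
    have hxU : x ∈ ⋃ s ∈ S, convexHull ℝ (range s.points) := by
      refine closure_minimal ?_ (IsPolytope.isCompact_biUnion_simplex hS).isClosed hx.1
      rw [hTS]; exact interior_subset
    obtain ⟨s, hs, hxs⟩ := mem_iUnion₂.1 hxU
    -- A boundary point lies in some closed simplex but not in its interior, so one of its
    -- barycentric coordinates vanishes.
    have hxint : x ∉ interior (convexHull ℝ (range (B s))) := fun h => hx.2 (by
      rw [hTS]
      exact interior_mono (subset_biUnion_of_mem (u := fun s : Affine.Simplex ℝ (E d) d =>
        convexHull ℝ (range s.points)) hs) h)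
    rw [AffineBasis.interior_convexHull] at hxint
    have hx0 : ∀ i, 0 ≤ (B s).coord i x := by
      have : x ∈ convexHull ℝ (range (B s)) := hxs
      rwa [AffineBasis.convexHull_eq_nonneg_coord] at this
    have : ∃ i, (B s).coord i x = 0 := by
      by_contra! hc
      exact hxint fun i => (hx0 i).lt_of_ne (hc i).symm
    obtain ⟨i, hi⟩ := this
    let K : 𝓗 := ⟨hyperplane (n s i) (b s i), ⟨(s, i), ⟨hs, mem_univ _⟩, rfl⟩⟩
    refine mem_iUnion.2 ⟨e K, ?_⟩
    rw [heq, Equiv.symm_apply_apply]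
    exact hsub s i hi

/-- The open half ball is connected and misses ∂T, so it lies in T as soon as it meets T; a small
shift of z along n gives such a point. -/
theorem IsPolytope.halfBall_subset {d : ℕ} {T : Set (E d)} (hT : IsPolytope T)
    {x z n : E d} {b r : ℝ} (hn : ‖n‖ = 1) (hfr : ∀ y ∈ frontier T, dist y x < r → inner ℝ n y = b)
    (hz : dist z x < r) (hzn : inner ℝ n z = b) (hzT : z ∈ T) :
    Metric.ball x r ∩ {y | b < inner ℝ n y} ⊆ T := by
  have hconv : Convex ℝ (Metric.ball x r ∩ {y | b < inner ℝ n y}) :=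
    (convex_ball x r).inter (convex_halfSpace_gt (innerₗ (E d) n).isLinear b)
  have hsub : Metric.ball x r ∩ {y | b < inner ℝ n y} ⊆ T ∪ (closure T)ᶜ := by
    rintro y ⟨hy, hyb⟩
    by_cases hyT : y ∈ T
    · exact Or.inl hyT
    · refine Or.inr fun hyc => ?_
      have : y ∈ frontier T := by rw [hT.isOpen.frontier_eq]; exact ⟨hyc, hyT⟩
      exact (hfr y this hy).not_gt hyb
  have hlim : Tendsto (fun t : ℝ => z + t • n) (𝓝[>] 0) (𝓝 z) := by
    have : Continuous fun t : ℝ => z + t • n := by fun_prop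
    have h0 := this.tendsto 0
    simp only [zero_smul, add_zero] at h0
    exact h0.mono_left nhdsWithin_le_nhds
  have hev := (hlim.eventually (hT.isOpen.mem_nhds hzT)).and
    ((hlim.eventually (Metric.isOpen_ball.mem_nhds (show z ∈ Metric.ball x r from hz))).and
      self_mem_nhdsWithin)
  obtain ⟨t, htT, htB, ht⟩ := hev.exists
  have htb : b < inner ℝ n (z + t • n) := by
    rw [inner_add_right, hzn, inner_smul_right, real_inner_self_eq_norm_sq, hn]
    simpa using ht
  exact hconv.isPreconnected.subset_left_of_subset_union hT.isOpen isClosed_closure.isOpen_compl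
    (disjoint_compl_right.mono_left subset_closure) hsub ⟨_, ⟨htB, htb⟩, htT⟩

/-- If, near a boundary point, the boundary of a polytope is contained in a hyperplane, then the
polytope does not meet this hyperplane near this point. -/
theorem IsPolytope.notMem_of_mem_hyperplane {d : ℕ} {T : Set (E d)} (hT : IsPolytope T)
    {x z n : E d} {b r : ℝ} (hn : ‖n‖ = 1) (hx : x ∈ frontier T)
    (hfr : ∀ y ∈ frontier T, dist y x < r → inner ℝ n y = b)
    (hz : dist z x < r) (hzn : inner ℝ n z = b) : z ∉ T := by
  intro hzT
  -- If z were in T, both half balls would be in T, and x would be interior to the closure of T.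
  have h1 := hT.halfBall_subset hn hfr hz hzn hzT
  have h2 := hT.halfBall_subset (n := -n) (b := -b) (by rwa [norm_neg])
    (fun y hy hyr => by rw [inner_neg_left, hfr y hy hyr]) hz (by rw [inner_neg_left, hzn]) hzT
  have hball : Metric.ball x r ⊆ closure T := by
    intro w hw
    rcases lt_trichotomy (inner ℝ n w) b with hlt | heq | hgt
    · exact subset_closure (h2 ⟨hw, by rw [mem_ofPred_eq, inner_neg_left]; linarith⟩)
    · have hlim : Tendsto (fun t : ℝ => w + t • n) (𝓝[>] 0) (𝓝 w) := by
        have : Continuous fun t : ℝ => w + t • n := by fun_prop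
        have h0 := this.tendsto 0
        simp only [zero_smul, add_zero] at h0
        exact h0.mono_left nhdsWithin_le_nhds
      refine mem_closure_of_tendsto hlim ?_
      filter_upwards [hlim.eventually (Metric.isOpen_ball.mem_nhds hw),
        self_mem_nhdsWithin] with t ht ht0
      refine h1 ⟨ht, ?_⟩
      change b < inner ℝ n (w + t • n)
      rw [inner_add_right, heq, inner_smul_right, real_inner_self_eq_norm_sq, hn]
      simpa using ht0
    · exact subset_closure (h1 ⟨hw, hgt⟩)
  have hxT : x ∈ T := hT.interior_closure_subset
    (interior_maximal hball Metric.isOpen_ball (Metric.mem_ball_self (dist_nonneg.trans_lt hz)))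
  rw [hT.isOpen.frontier_eq] at hx
  exact hx.2 hxT

/-- A set which is star-shaped with respect to all points of a ball contains the half-open segments
from the points of this ball to the points of its closure. -/
theorem add_smul_sub_mem_of_starConvex {d : ℕ} {Y : Set (E d)} {c : E d} {ρ : ℝ}
    (hY : ∀ y ∈ Metric.ball c ρ, StarConvex ℝ y Y) {q x : E d} (hq : q ∈ Metric.ball c ρ)
    (hx : x ∈ closure Y) {s : ℝ} (hs0 : 0 ≤ s) (hs1 : s < 1) : q + s • (x - q) ∈ Y := by
  have hs : 0 < 1 - s := by linarith
  -- Approximate x by x' ∈ Y and correct q so that the point at parameter s is unchanged; the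
  -- corrected q stays in the ball.
  have hlim : Tendsto (fun x' => q + (s / (1 - s)) • (x - x')) (𝓝[Y] x) (𝓝 q) := by
    have : Continuous fun x' => q + (s / (1 - s)) • (x - x') := by fun_prop
    have h0 := this.tendsto x
    simp only [sub_self, smul_zero, add_zero] at h0
    exact h0.mono_left nhdsWithin_le_nhds
  have : (𝓝[Y] x).NeBot := mem_closure_iff_nhdsWithin_neBot.1 hx
  obtain ⟨x', hq', hx'⟩ := ((hlim.eventually (Metric.isOpen_ball.mem_nhds hq)).and
    self_mem_nhdsWithin).exists
  have h1 := hY _ hq' hx' hs.le hs0 (by ring)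
  have h2 : (1 - s) • (q + (s / (1 - s)) • (x - x')) + s • x' = q + s • (x - q) := by
    rw [smul_add, smul_smul, mul_div_cancel₀ _ hs.ne']
    module
  rwa [h2] at h1

/-- The trace inequality on the part of the boundary of a polytope which is in the closure of a
star-shaped set. -/
theorem IsPolytope.lintegral_surface_le {d : ℕ} (hd : 1 ≤ d) {T Y : Set (E d)} (hT : IsPolytope T)
    (hYT : Y ⊆ T) {c : E d} {ρ h : ℝ} (hρ : 0 < ρ)
    (hstar : ∀ y ∈ Metric.ball c ρ, StarConvex ℝ y Y) (hh : ∀ x ∈ closure Y, ‖x - c‖ ≤ h)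
    {f : E d → ℝ} (hf : ContDiff ℝ 1 f) :
    ENNReal.ofReal ρ * ∫⁻ x in frontier T ∩ closure Y, ‖f x‖ₑ ^ 2 ∂(surface d) ≤
      ∫⁻ z in Y, ENNReal.ofReal ((d + 1) * f z ^ 2 + h ^ 2 * ‖gradient f z‖ ^ 2) := by
  obtain ⟨ι, hι, n, b, hn, hinj, hcov⟩ := hT.exists_hyperplanes hd
  have hTfr : Disjoint (frontier T) T := by
    rw [hT.isOpen.frontier_eq]; exact disjoint_sdiff_left
  refine lintegral_surface_le_of_cone hd
    (isClosed_frontier.inter isClosed_closure).measurableSet hn hinj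
    (inter_subset_left.trans hcov) (c := c) hρ ?_ (fun x hx => hh x hx.2)
    (hTfr.mono inter_subset_left hYT) ?_ hf
  · rintro i x ⟨hxT, hxY⟩ hxi hxj
    -- Otherwise the projection q of c on the hyperplane is in the ball. The segment from q to x
    -- runs in the hyperplane and, short of x, in Y ⊆ T, although T avoids this hyperplane near x.
    by_contra! hlt
    have hclosed : IsClosed (⋃ j : {j // j ≠ i}, hyperplane (n j) (b j)) :=
      isClosed_iUnion_of_finite fun j => isClosed_hyperplane _ _
    have hxn : x ∈ (⋃ j : {j // j ≠ i}, hyperplane (n j) (b j))ᶜ := by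
      simp only [mem_compl_iff, mem_iUnion, not_exists]
      exact fun j => hxj j j.2
    obtain ⟨r, hr, hball⟩ := Metric.isOpen_iff.1 hclosed.isOpen_compl x hxn
    have hfr : ∀ y ∈ frontier T, dist y x < r → inner ℝ (n i) y = b i := by
      intro y hy hyr
      obtain ⟨j, hj⟩ := mem_iUnion.1 (hcov hy)
      by_cases hji : j = i
      · exact hji ▸ hj
      · exact absurd (mem_iUnion.2 ⟨⟨j, hji⟩, hj⟩) (hball hyr)
    set q := c + (b i - inner ℝ (n i) c) • n i with hqdef
    have hq : q ∈ Metric.ball c ρ := by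
      rw [Metric.mem_ball, dist_eq_norm, hqdef, add_sub_cancel_left, norm_smul, hn, mul_one]
      exact hlt
    have hqn : inner ℝ (n i) q = b i := by
      rw [hqdef, inner_add_right, inner_smul_right, real_inner_self_eq_norm_sq, hn]; ring
    have hlim : Tendsto (fun s : ℝ => q + s • (x - q)) (𝓝[<] 1) (𝓝 x) := by
      have : Continuous fun s : ℝ => q + s • (x - q) := by fun_prop
      have h0 := this.tendsto 1
      simp only [one_smul, add_sub_cancel] at h0
      exact h0.mono_left nhdsWithin_le_nhds
    have h01 : ∀ᶠ s : ℝ in 𝓝[<] 1, s ∈ Ioo (0 : ℝ) 1 := Ioo_mem_nhdsLT zero_lt_one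
    obtain ⟨s, hs, hsr⟩ := (h01.and (hlim.eventually (Metric.ball_mem_nhds x hr))).exists
    have hzY := add_smul_sub_mem_of_starConvex hstar hq hxY hs.1.le hs.2
    refine hT.notMem_of_mem_hyperplane (hn i) hxT hfr hsr ?_ (hYT hzY)
    have hxb : inner ℝ (n i) x = b i := hxi
    rw [inner_add_right, inner_smul_right, inner_sub_right, hqn, hxb]; ring
  · rintro x ⟨-, hxY⟩ s hs
    exact add_smul_sub_mem_of_starConvex hstar (Metric.mem_ball_self hρ) hxY hs.1.le hs.2

/-! ### Poincaré and trace inequalities on an element -/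

/-- A bounded open set `T` of diameter at most `h` is the union of `N` open sets `Y i`, star-shaped
with respect to all points of balls of radius `ρ`, and linked by chains in which consecutive sets
share a ball of radius `ρ`. -/
structure StarCover {d : ℕ} (T : Set (E d)) (N : ℕ) (ρ h : ℝ) where
  piece : Fin N → Set (E d)
  center : Fin N → E d
  eq_iUnion : T = ⋃ i, piece i
  isOpen : ∀ i, IsOpen (piece i)
  ball_subset : ∀ i, Metric.ball (center i) ρ ⊆ piece i
  starConvex : ∀ i, ∀ y ∈ Metric.ball (center i) ρ, StarConvex ℝ y (piece i)
  chain : ∀ i j, Relation.ReflTransGen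
    (fun a b => ∃ z, Metric.ball z ρ ⊆ piece a ∩ piece b) i j
  dist_le : ∀ x ∈ closure T, ∀ y ∈ closure T, dist x y ≤ h

theorem IsPolytope.nonempty_starCover {d : ℕ} {T : Set (E d)} (hT : IsPolytope T) {ϱ : ℝ}
    (hϱ : 0 < ϱ) (h : ConnectedByStarShapedSets ϱ T) :
    ∃ N ≤ ⌊ϱ⁻¹⌋₊, Nonempty (StarCover T N (ϱ * Metric.diam T) (Metric.diam T)) := by
  obtain ⟨N, Y, hN, hTY, hopen, hstar, hchain⟩ := h
  -- Since T is open, relative openness and relative balls are the usual ones.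
  have hspan : affineSpan ℝ T = ⊤ := hT.isOpen.affineSpan_eq_top hT.nonempty
  simp only [hspan, AffineSubspace.top_coe, inter_univ, AffineSubspace.mem_top, true_and]
    at hopen hstar hchain
  choose c hc using hstar
  refine ⟨N, Nat.le_floor ?_, ⟨⟨Y, c, hTY, fun i => ?_, fun i y hy => (hc i y hy).1,
    fun i y hy => (hc i y hy).2, hchain, fun x hx y hy => ?_⟩⟩⟩
  · rwa [← one_div, le_div_iff₀ hϱ]
  · obtain ⟨U, hU, hYU⟩ := hopen i
    rwa [hYU]
  · rw [← Metric.diam_closure]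
    exact Metric.dist_le_diam_of_mem hT.isBounded.closure hx hy

/-- The bound on `|T| / |B|` for `T` of diameter `h` and a ball `B` of radius `ϱ h`. -/
noncomputable def volumeRatio (d : ℕ) (ϱ : ℝ) : ℝ≥0∞ := ENNReal.ofReal (ϱ⁻¹ ^ d)

/-- The constant in the Poincaré inequality. -/
noncomputable def poincareConst (d : ℕ) (ϱ : ℝ) : ℝ≥0∞ :=
  ⌊ϱ⁻¹⌋₊ * (2 + 8 * ⌊ϱ⁻¹⌋₊ ^ 2 * volumeRatio d ϱ) * (2 ^ d * (volumeRatio d ϱ + 1))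

/-- The constant in the trace inequality. -/
noncomputable def traceConst (d : ℕ) (ϱ : ℝ) : ℝ≥0∞ :=
  ENNReal.ofReal ϱ⁻¹ * (⌊ϱ⁻¹⌋₊ * ((d + 1) * poincareConst d ϱ + 1))

theorem poincareConst_ne_top (d : ℕ) (ϱ : ℝ) : poincareConst d ϱ ≠ ⊤ := by
  simp [poincareConst, volumeRatio, ENNReal.mul_eq_top]

theorem traceConst_ne_top (d : ℕ) (ϱ : ℝ) : traceConst d ϱ ≠ ⊤ := by
  simp [traceConst, ENNReal.mul_eq_top, poincareConst_ne_top]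

namespace StarCover

variable {d N : ℕ} {T : Set (E d)} {ϱ h : ℝ}

theorem piece_subset {ρ : ℝ} (S : StarCover T N ρ h) (i : Fin N) : S.piece i ⊆ T :=
  (subset_iUnion _ i).trans S.eq_iUnion.ge

theorem volume_le (hϱ : 0 < ϱ) (hh : 0 < h) (S : StarCover T N (ϱ * h) h) (hne : T.Nonempty) :
    volume T ≤ volumeRatio d ϱ * volume (Metric.ball (0 : E d) (ϱ * h)) := by
  obtain ⟨x, hx⟩ := hne
  have h1 : T ⊆ Metric.closedBall x h := fun y hy =>
    S.dist_le y (subset_closure hy) x (subset_closure hx)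
  refine (measure_mono h1).trans (le_of_eq ?_)
  rw [Measure.addHaar_closedBall _ _ hh.le, Measure.addHaar_ball_of_pos _ (0 : E d) (r := ϱ * h) (by positivity),
    ← mul_assoc, volumeRatio, ← ENNReal.ofReal_mul (by positivity), finrank_euclideanSpace,
    Fintype.card_fin, ← mul_pow, inv_mul_cancel_left₀ hϱ.ne']

/-- The Poincaré inequality, given on the pieces with the ball of star-shapedness. -/
theorem exists_const_lintegral_sub_le (hϱ : 0 < ϱ) (hh : 0 < h) (hN : N ≤ ⌊ϱ⁻¹⌋₊)
    (S : StarCover T N (ϱ * h) h) (hne : T.Nonempty) {U : E d → ℝ} (hU : Measurable U) {J : ℝ≥0∞}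
    (hpiece : ∀ i, ∃ m : ℝ, volume (Metric.ball (S.center i) (ϱ * h)) *
      ∫⁻ x in S.piece i, ‖U x - m‖ₑ ^ 2 ≤
        2 ^ d * (volume (S.piece i) + volume (Metric.ball (S.center i) (ϱ * h))) * J) :
    ∃ m : ℝ, ∫⁻ x in T, ‖U x - m‖ₑ ^ 2 ≤ poincareConst d ϱ * J := by
  set β := volume (Metric.ball (0 : E d) (ϱ * h)) with hβ
  set R := volumeRatio d ϱ with hR
  have hball : ∀ c : E d, volume (Metric.ball c (ϱ * h)) = β := fun c =>
    Measure.addHaar_ball_center _ _ _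
  have hβ0 : β ≠ 0 := (Metric.measure_ball_pos _ _ (by positivity)).ne'
  have hβ1 : β ≠ ⊤ := measure_ball_lt_top.ne
  have hvol : volume T ≤ R * β := S.volume_le hϱ hh hne
  set I := 2 ^ d * (R + 1) * J with hI
  have hm : ∀ i, ∃ m : ℝ, ∫⁻ x in S.piece i, ‖U x - m‖ₑ ^ 2 ≤ I := by
    intro i
    obtain ⟨m, hm⟩ := hpiece i
    refine ⟨m, ?_⟩
    rw [hball] at hm
    refine (ENNReal.mul_le_mul_iff_right hβ0 hβ1).1 (hm.trans ?_)
    calc 2 ^ d * (volume (S.piece i) + β) * J ≤ 2 ^ d * (R * β + β) * J := by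
          gcongr
          exact (measure_mono (S.piece_subset i)).trans hvol
      _ = β * I := by rw [hI]; ring
  have hchain : ∀ i j, Relation.ReflTransGen
      (fun a c => ∃ B', β ≤ volume B' ∧ B' ⊆ S.piece a ∩ S.piece c) i j := by
    intro i j
    refine Relation.ReflTransGen.mono ?_ _ _ (S.chain i j)
    rintro a b ⟨z, hz⟩
    exact ⟨_, (hball z).ge, hz⟩
  obtain ⟨m, hmT⟩ := exists_const_lintegral_sub_le_of_chain hU hβ0 hβ1 hchain hm
  rw [← S.eq_iUnion] at hmT
  refine ⟨m, hmT.trans ?_⟩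
  -- The ball volume β cancels, which makes the constant independent of h.
  have hc : 4 * I / β * volume T ≤ 4 * I * R := by
    calc 4 * I / β * volume T ≤ 4 * I / β * (R * β) := by gcongr
      _ = 4 * I / β * β * R := by ring
      _ = 4 * I * R := by rw [ENNReal.div_mul_cancel hβ0 hβ1]
  have hN' : (N : ℝ≥0∞) ≤ ⌊ϱ⁻¹⌋₊ := by exact_mod_cast hN
  calc (N : ℝ≥0∞) * (2 * I + 2 * (N ^ 2 * (4 * I / β)) * volume T)
      = N * (2 * I + 2 * N ^ 2 * (4 * I / β * volume T)) := by ring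
    _ ≤ ⌊ϱ⁻¹⌋₊ * (2 * I + 2 * ⌊ϱ⁻¹⌋₊ ^ 2 * (4 * I * R)) := by gcongr
    _ = poincareConst d ϱ * J := by rw [poincareConst, hI, ← hR]; ring

theorem dist_le_of_mem {ρ : ℝ} (S : StarCover T N ρ h) {i : Fin N} {x y : E d}
    (hx : x ∈ S.piece i) (hy : y ∈ Metric.ball (S.center i) ρ) : dist x y ≤ h :=
  S.dist_le _ (subset_closure (S.piece_subset i hx)) _
    (subset_closure (S.piece_subset i (S.ball_subset i hy)))

theorem segment_subset {ρ : ℝ} (S : StarCover T N ρ h) {i : Fin N} {x y : E d}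
    (hx : x ∈ S.piece i) (hy : y ∈ Metric.ball (S.center i) ρ) : segment ℝ y x ⊆ T :=
  ((S.starConvex i y hy).segment_subset hx).trans (S.piece_subset i)

theorem isOpen_self {ρ : ℝ} (S : StarCover T N ρ h) : IsOpen T :=
  S.eq_iUnion ▸ isOpen_iUnion S.isOpen

/-- The Poincaré inequality in `H¹(T)`. -/
theorem poincare_H1 (hϱ : 0 < ϱ) (hh : 0 < h) (hN : N ≤ ⌊ϱ⁻¹⌋₊)
    (S : StarCover T N (ϱ * h) h) (hne : T.Nonempty) {u : L2 T × L2V T} (hu : u ∈ H1 T) :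
    ∃ m : ℝ, ∫⁻ x in T, ‖u.1 x - m‖ₑ ^ 2 ≤
      poincareConst d ϱ * (ENNReal.ofReal h ^ 2 * ∫⁻ x in T, ‖u.2 x‖ₑ ^ 2) :=
  S.exists_const_lintegral_sub_le hϱ hh hN hne (Lp.stronglyMeasurable u.1).measurable fun i =>
    H1.exists_const_lintegral_sub_le S.isOpen_self hu (S.piece_subset i)
      (S.isOpen i).measurableSet measurableSet_ball
      (Metric.measure_ball_pos _ _ (by positivity)).ne' measure_ball_lt_top.ne
      (fun _ hx _ hy => S.dist_le_of_mem hx hy) (fun _ hx _ hy => S.segment_subset hx hy)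

/-- The Poincaré inequality for smooth functions. -/
theorem poincare_contDiff (hϱ : 0 < ϱ) (hh : 0 < h) (hN : N ≤ ⌊ϱ⁻¹⌋₊)
    (S : StarCover T N (ϱ * h) h) (hne : T.Nonempty) {f : E d → ℝ} (hf : ContDiff ℝ 1 f) :
    ∃ m : ℝ, ∫⁻ x in T, ‖f x - m‖ₑ ^ 2 ≤
      poincareConst d ϱ * (ENNReal.ofReal h ^ 2 * ∫⁻ x in T, ‖gradient f x‖ₑ ^ 2) :=
  S.exists_const_lintegral_sub_le hϱ hh hN hne hf.continuous.measurable fun i =>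
    ContDiff.exists_const_lintegral_sub_le S.isOpen_self hf
      (S.isOpen i).measurableSet measurableSet_ball
      (Metric.measure_ball_pos _ _ (by positivity)).ne' measure_ball_lt_top.ne
      (fun _ hx _ hy => S.dist_le_of_mem hx hy) (fun _ hx _ hy => S.segment_subset hx hy)

/-- The closures of the finitely many pieces cover ∂T; each contributes an integral over at most T,
hence the factor N. -/
theorem lintegral_surface_le (hd : 1 ≤ d) (hT : IsPolytope T) {ρ : ℝ} (hρ : 0 < ρ)
    (S : StarCover T N ρ h) {f : E d → ℝ} (hf : ContDiff ℝ 1 f) :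
    ENNReal.ofReal ρ * ∫⁻ x in frontier T, ‖f x‖ₑ ^ 2 ∂(surface d) ≤
      N * ∫⁻ z in T, ENNReal.ofReal ((d + 1) * f z ^ 2 + h ^ 2 * ‖gradient f z‖ ^ 2) := by
  have hcov : frontier T ⊆ ⋃ i, frontier T ∩ closure (S.piece i) := by
    intro x hx
    have h1 : x ∈ closure (⋃ i, S.piece i) := S.eq_iUnion ▸ frontier_subset_closure hx
    rw [closure_iUnion_of_finite] at h1
    obtain ⟨i, hi⟩ := mem_iUnion.1 h1
    exact mem_iUnion.2 ⟨i, hx, hi⟩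
  calc ENNReal.ofReal ρ * ∫⁻ x in frontier T, ‖f x‖ₑ ^ 2 ∂(surface d)
      ≤ ENNReal.ofReal ρ *
          ∑ i, ∫⁻ x in frontier T ∩ closure (S.piece i), ‖f x‖ₑ ^ 2 ∂(surface d) := by
        refine mul_le_mul_right ((lintegral_mono_set hcov).trans ?_) _
        exact (lintegral_iUnion_le _ _).trans (by rw [tsum_fintype])
    _ = ∑ i, ENNReal.ofReal ρ *
          ∫⁻ x in frontier T ∩ closure (S.piece i), ‖f x‖ₑ ^ 2 ∂(surface d) := Finset.mul_sum _ _ _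
    _ ≤ ∑ _i : Fin N,
          ∫⁻ z in T, ENNReal.ofReal ((d + 1) * f z ^ 2 + h ^ 2 * ‖gradient f z‖ ^ 2) := by
        refine Finset.sum_le_sum fun i _ => ?_
        refine (hT.lintegral_surface_le hd (S.piece_subset i) hρ (S.starConvex i)
          (fun x hx => ?_) hf).trans (lintegral_mono_set (S.piece_subset i))
        rw [← dist_eq_norm]
        exact S.dist_le _ (closure_mono (S.piece_subset i) hx) _ (subset_closure
          (S.piece_subset i (S.ball_subset i (Metric.mem_ball_self hρ))))
    _ = _ := by rw [Finset.sum_const, Finset.card_univ, Fintype.card_fin, nsmul_eq_mul]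

/-- This is the trace inequality for f = 1. It puts constants in L²(∂T). -/
theorem surface_frontier_lt_top (hd : 1 ≤ d) (hT : IsPolytope T) {ρ : ℝ} (hρ : 0 < ρ)
    (S : StarCover T N ρ h) : surface d (frontier T) < ⊤ := by
  have h1 := S.lintegral_surface_le hd hT hρ (f := fun _ => (1 : ℝ)) contDiff_const
  have hg : ∀ z : E d, gradient (fun _ : E d => (1 : ℝ)) z = 0 := fun z => by simp [gradient]
  simp only [enorm_one, one_pow, setLIntegral_const, one_mul, hg, norm_zero] at h1
  refine ENNReal.lt_top_of_mul_ne_top_right (ne_top_of_le_ne_top ?_ h1)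
    (by simpa using hρ)
  exact ENNReal.mul_ne_top (ENNReal.natCast_ne_top _)
    (ENNReal.mul_ne_top ENNReal.ofReal_ne_top hT.isBounded.measure_lt_top.ne)

/-- The trace inequality combined with the Poincaré inequality. -/
theorem trace_contDiff (hd : 1 ≤ d) (hT : IsPolytope T) (hϱ : 0 < ϱ) (hh : 0 < h)
    (hN : N ≤ ⌊ϱ⁻¹⌋₊) (S : StarCover T N (ϱ * h) h) {f : E d → ℝ} (hf : ContDiff ℝ 1 f) :
    ∃ m : ℝ, ∫⁻ x in frontier T, ‖f x - m‖ₑ ^ 2 ∂(surface d) ≤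
      traceConst d ϱ * (ENNReal.ofReal h * ∫⁻ x in T, ‖gradient f x‖ₑ ^ 2) := by
  obtain ⟨m, hm⟩ := S.poincare_contDiff hϱ hh hN hT.nonempty hf
  refine ⟨m, ?_⟩
  set J := ∫⁻ x in T, ‖gradient f x‖ₑ ^ 2 with hJ
  have h1 := S.lintegral_surface_le hd hT (by positivity) (hf.sub contDiff_const (g := fun _ => m))
  have hgr : ∀ z, gradient (fun x => f x - m) z = gradient f z := fun z => by
    simp [gradient, fderiv_sub_const]
  have h2 : ∫⁻ z in T, ENNReal.ofReal ((d + 1) * (f z - m) ^ 2 + h ^ 2 * ‖gradient f z‖ ^ 2) =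
      (d + 1) * (∫⁻ z in T, ‖f z - m‖ₑ ^ 2) + ENNReal.ofReal h ^ 2 * J := by
    have hfm := hf.continuous.measurable
    rw [hJ, ← lintegral_const_mul _ (by fun_prop), ← lintegral_const_mul _
      ((continuous_gradient hf).enorm.measurable.pow_const 2), ← lintegral_add_left (by fun_prop)]
    refine lintegral_congr fun z => ?_
    rw [ENNReal.ofReal_add (by positivity) (by positivity), ENNReal.ofReal_mul (by positivity),
      ENNReal.ofReal_mul (by positivity), enorm_sq_eq_ofReal, ENNReal.ofReal_pow hh.le,
      ENNReal.ofReal_pow (norm_nonneg _), ofReal_norm, ENNReal.ofReal_add (by positivity)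
      zero_le_one, ENNReal.ofReal_natCast, ENNReal.ofReal_one]
  simp only [hgr] at h1
  rw [h2] at h1
  have hN' : (N : ℝ≥0∞) ≤ ⌊ϱ⁻¹⌋₊ := by exact_mod_cast hN
  -- The factor h² from Poincaré against ϱh on the left leaves h/ϱ.
  have h3 : ENNReal.ofReal (ϱ * h) * ∫⁻ x in frontier T, ‖f x - m‖ₑ ^ 2 ∂(surface d) ≤
      ENNReal.ofReal (ϱ * h) * (traceConst d ϱ * (ENNReal.ofReal h * J)) := by
    calc _ ≤ _ := h1
      _ ≤ ⌊ϱ⁻¹⌋₊ * ((d + 1) * (poincareConst d ϱ * (ENNReal.ofReal h ^ 2 * J)) +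
            ENNReal.ofReal h ^ 2 * J) := by gcongr
      _ = 1 * (⌊ϱ⁻¹⌋₊ * ((d + 1) * poincareConst d ϱ + 1) * (ENNReal.ofReal h ^ 2 * J)) := by
          ring
      _ = ENNReal.ofReal ϱ * ENNReal.ofReal ϱ⁻¹ *
            (⌊ϱ⁻¹⌋₊ * ((d + 1) * poincareConst d ϱ + 1) * (ENNReal.ofReal h ^ 2 * J)) := by
          rw [← ENNReal.ofReal_mul hϱ.le, mul_inv_cancel₀ hϱ.ne', ENNReal.ofReal_one]
      _ = _ := by rw [ENNReal.ofReal_mul hϱ.le, traceConst]; ring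
  have hpos : ENNReal.ofReal (ϱ * h) ≠ 0 := by
    rw [Ne, ENNReal.ofReal_eq_zero, not_le]; positivity
  exact (ENNReal.mul_le_mul_iff_right hpos ENNReal.ofReal_ne_top).1 h3

end StarCover

/-! ### Projection errors in L²(T) and L²(∂T) -/

theorem enorm_Lp_two_sq {α F : Type*} [MeasurableSpace α] [NormedAddCommGroup F] {μ : Measure α}
    (f : Lp F 2 μ) : ‖f‖ₑ ^ 2 = ∫⁻ x, ‖f x‖ₑ ^ 2 ∂μ := by
  rw [Lp.enorm_def, eLpNorm_eq_lintegral_rpow_enorm_toReal (by norm_num) (by norm_num),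
    ← ENNReal.rpow_two, ← ENNReal.rpow_mul]
  norm_num

theorem enorm_Lp_two_sub_const_sq {α : Type*} [MeasurableSpace α] {μ : Measure α}
    [IsFiniteMeasure μ] (f : Lp ℝ 2 μ) (m : ℝ) :
    ‖f - Lp.const 2 μ m‖ₑ ^ 2 = ∫⁻ x, ‖f x - m‖ₑ ^ 2 ∂μ := by
  rw [enorm_Lp_two_sq]
  refine lintegral_congr_ae ?_
  filter_upwards [Lp.coeFn_sub f (Lp.const 2 μ m), Lp.coeFn_const (p := 2) (μ := μ) m] with x h1 h2
  rw [h1, Pi.sub_apply, h2, Function.const_apply]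

theorem norm_sub_proj_le {H : Type*} [NormedAddCommGroup H] [InnerProductSpace ℝ H]
    [CompleteSpace H] {S : Submodule ℝ H} (f : H) {g : H} (hg : g ∈ S) :
    ‖f - proj S f‖ ≤ ‖f - g‖ := by
  rw [proj, Submodule.starProjection_minimal]
  exact ciInf_le ⟨0, by rintro _ ⟨x, rfl⟩; exact norm_nonneg _⟩
    (⟨g, S.le_topologicalClosure hg⟩ : S.topologicalClosure)

theorem const_mem_polySpace {d : ℕ} (k : ℕ) (μ : Measure (E d)) [IsFiniteMeasure μ] (m : ℝ) :
    Lp.const 2 μ m ∈ polySpace k μ := by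
  refine Submodule.subset_span ⟨MvPolynomial.C m, by simp, ?_⟩
  filter_upwards [Lp.coeFn_const (p := 2) (μ := μ) m] with x hx
  rw [hx, MvPolynomial.eval_C, Function.const_apply]

theorem const_mem_cellSpace {d : ℕ} (W : Submodule ℝ (E d → ℝ)) (k : ℕ) (T : Set (E d))
    [IsFiniteMeasure ((volume : Measure (E d)).restrict T)] (m : ℝ) :
    Lp.const 2 (volume.restrict T) m ∈ cellSpace W k T :=
  Submodule.mem_sup_left (const_mem_polySpace k _ m)

theorem const_mem_bdrySpace {d : ℕ} {Ω : Set (E d)} (M : PolytopalMesh Ω)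
    (W : Submodule ℝ (E d → ℝ)) (k : ℕ) (T : Set (E d))
    [hfin : IsFiniteMeasure ((surface d).restrict (frontier T))] (m : ℝ) :
    Lp.const 2 ((surface d).restrict (frontier T)) m ∈ bdrySpace M W k T := by
  intro F hF
  have : IsFiniteMeasure ((surface d).restrict F) :=
    isFiniteMeasure_of_le _ (Measure.restrict_mono hF.2 le_rfl)
  refine ⟨Lp.const 2 _ m, Submodule.mem_sup_left (const_mem_polySpace k _ m), ?_⟩
  have h1 : Lp.const 2 ((surface d).restrict (frontier T)) m =ᵐ[(surface d).restrict F]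
      Function.const (E d) m :=
    ae_restrict_of_ae_restrict_of_subset hF.2 (Lp.coeFn_const (p := 2) _ m)
  exact h1.trans (Lp.coeFn_const (p := 2) _ m).symm

theorem sq_norm_le_of_sq_enorm_le {F G : Type*} [SeminormedAddCommGroup F]
    [SeminormedAddCommGroup G] {a : F} {b : G} {K : ℝ≥0∞} (hK : K ≠ ⊤) {r : ℝ} (hr : 0 ≤ r)
    (h : ‖a‖ₑ ^ 2 ≤ K * (ENNReal.ofReal r * ‖b‖ₑ ^ 2)) : ‖a‖ ^ 2 ≤ K.toReal * (r * ‖b‖ ^ 2) := by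
  rw [← ofReal_norm, ← ofReal_norm, ← ENNReal.ofReal_pow (norm_nonneg _),
    ← ENNReal.ofReal_pow (norm_nonneg _), ← ENNReal.ofReal_mul hr, ← ENNReal.ofReal_toReal hK,
    ← ENNReal.ofReal_mul ENNReal.toReal_nonneg] at h
  exact (ENNReal.ofReal_le_ofReal_iff (by positivity)).1 h

section

variable {d N : ℕ} {T : Set (E d)} {ϱ h : ℝ}

/-- The projection error on the element is controlled by the gradient. -/
theorem sq_norm_sub_proj_cellSpace_le (hT : IsPolytope T) (hϱ : 0 < ϱ) (hh : 0 < h)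
    (hN : N ≤ ⌊ϱ⁻¹⌋₊) (S : StarCover T N (ϱ * h) h) (W : Submodule ℝ (E d → ℝ)) (k : ℕ)
    {u : L2 T × L2V T} (hu : u ∈ H1 T) :
    ‖u.1 - proj (cellSpace W k T) u.1‖ ^ 2 ≤ (poincareConst d ϱ).toReal * (h ^ 2 * ‖u.2‖ ^ 2) := by
  have : IsFiniteMeasure ((volume : Measure (E d)).restrict T) :=
    ⟨by simpa using hT.isBounded.measure_lt_top⟩
  obtain ⟨m, hm⟩ := S.poincare_H1 hϱ hh hN hT.nonempty hu
  rw [← enorm_Lp_two_sub_const_sq, ← enorm_Lp_two_sq, ← ENNReal.ofReal_pow hh.le] at hm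
  refine le_trans ?_ (sq_norm_le_of_sq_enorm_le (poincareConst_ne_top d ϱ) (by positivity) hm)
  gcongr
  exact norm_sub_proj_le _ (const_mem_cellSpace W k T m)

theorem sq_norm_sub_proj_bdrySpace_le_of_isTest {Ω : Set (E d)} (M : PolytopalMesh Ω) (hd : 1 ≤ d)
    (hT : IsPolytope T) (hϱ : 0 < ϱ) (hh : 0 < h) (hN : N ≤ ⌊ϱ⁻¹⌋₊)
    (S : StarCover T N (ϱ * h) h) (W : Submodule ℝ (E d → ℝ)) (k : ℕ) {φ : E d → ℝ}
    (hφ : IsTest φ) {G : L2V T} {g : L2B T} (hG : G =ᵐ[volume.restrict T] gradient φ)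
    (hg : g =ᵐ[(surface d).restrict (frontier T)] φ) :
    ‖g - proj (bdrySpace M W k T) g‖ ^ 2 ≤ (traceConst d ϱ).toReal * (h * ‖G‖ ^ 2) := by
  have : IsFiniteMeasure ((surface d).restrict (frontier T)) :=
    ⟨by simpa using S.surface_frontier_lt_top hd hT (by positivity)⟩
  obtain ⟨m, hm⟩ := S.trace_contDiff hd hT hϱ hh hN (hφ.1.of_le (by norm_cast))
  have e3 : ‖g - Lp.const 2 _ m‖ₑ ^ 2 = ∫⁻ x in frontier T, ‖φ x - m‖ₑ ^ 2 ∂(surface d) := by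
    rw [enorm_Lp_two_sub_const_sq]
    exact lintegral_congr_ae (hg.mono fun x hx => by simp only [hx])
  have e2 : ‖G‖ₑ ^ 2 = ∫⁻ x in T, ‖gradient φ x‖ₑ ^ 2 := by
    rw [enorm_Lp_two_sq]
    exact lintegral_congr_ae (hG.mono fun x hx => by simp only [hx])
  rw [← e2, ← e3] at hm
  refine le_trans ?_ (sq_norm_le_of_sq_enorm_le (traceConst_ne_top d ϱ) hh.le hm)
  exact pow_le_pow_left₀ (norm_nonneg _)
    (norm_sub_proj_le _ (const_mem_bdrySpace M W k T m)) 2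

/-- The projection error of the trace on the boundary is controlled by the gradient. -/
theorem sq_norm_sub_proj_bdrySpace_le {Ω : Set (E d)} (M : PolytopalMesh Ω) (hd : 1 ≤ d)
    (hT : IsPolytope T) (hϱ : 0 < ϱ) (hh : 0 < h) (hN : N ≤ ⌊ϱ⁻¹⌋₊)
    (S : StarCover T N (ϱ * h) h) (W : Submodule ℝ (E d → ℝ)) (k : ℕ) {u : L2 T × L2V T}
    {g : L2B T} (hg : IsTrace T u g) :
    ‖g - proj (bdrySpace M W k T) g‖ ^ 2 ≤ (traceConst d ϱ).toReal * (h * ‖u.2‖ ^ 2) := by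
  have hp : Continuous (proj (bdrySpace M W k T)) :=
    (bdrySpace M W k T).topologicalClosure.starProjection.continuous
  have h1 : Continuous fun t : L2 T × L2V T × L2B T =>
      ‖t.2.2 - proj (bdrySpace M W k T) t.2.2‖ ^ 2 :=
    (((continuous_snd.comp continuous_snd).sub
      (hp.comp (continuous_snd.comp continuous_snd))).norm).pow 2
  have h2 : Continuous fun t : L2 T × L2V T × L2B T =>
      (traceConst d ϱ).toReal * (h * ‖t.2.1‖ ^ 2) :=
    ((((continuous_fst.comp continuous_snd).norm).pow 2).const_mul h).const_mul _
  -- The inequality is a closed condition on triples, so it passes to the closure that defines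
  -- traces.
  have hsub : smoothTriples T ⊆ {t | ‖t.2.2 - proj (bdrySpace M W k T) t.2.2‖ ^ 2 ≤
      (traceConst d ϱ).toReal * (h * ‖t.2.1‖ ^ 2)} := by
    rintro t ⟨φ, hφ, -, hG, hg⟩
    exact sq_norm_sub_proj_bdrySpace_le_of_isTest M hd hT hϱ hh hN S W k hφ hG hg
  have hmem : (u.1, u.2, g) ∈ closure (smoothTriples T) := hg
  have := closure_minimal hsub (isClosed_le h1 h2) hmem
  rwa [mem_ofPred_eq] at this

theorem recon_mem_H1 {Ω : Set (E d)} (M : PolytopalMesh Ω) (W : Submodule ℝ (E d → ℝ)) (k : ℕ)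
    (v : L2 T × L2B T) : recon M W k T v ∈ H1 T := by
  rw [recon]
  split_ifs with hex
  · exact hex.choose_spec.1.1
  -- The default value 0 also belongs to H¹(T).
  · intro φ _ _
    have h1 : ((0 : L2 T × L2V T).1 : E d → ℝ) =ᵐ[volume.restrict T] 0 := Lp.coeFn_zero _ _ _
    have h2 : ((0 : L2 T × L2V T).2 : E d → E d) =ᵐ[volume.restrict T] 0 := Lp.coeFn_zero _ _ _
    rw [integral_eq_zero_of_ae (h1.mono fun x hx => by simp only [hx, Pi.zero_apply, zero_smul]),
      integral_eq_zero_of_ae (h2.mono fun x hx => by simp only [hx, Pi.zero_apply, smul_zero]),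
      neg_zero]

theorem sq_norm_sub_proj_trace_le {Ω : Set (E d)} (M : PolytopalMesh Ω) (hd : 1 ≤ d)
    (hT : IsPolytope T) (hϱ : 0 < ϱ) (hh : 0 < h) (hN : N ≤ ⌊ϱ⁻¹⌋₊)
    (S : StarCover T N (ϱ * h) h) (W : Submodule ℝ (E d → ℝ)) (k : ℕ) (u : L2 T × L2V T) :
    ‖trace T u - proj (bdrySpace M W k T) (trace T u)‖ ^ 2 ≤
      (traceConst d ϱ).toReal * (h * ‖u.2‖ ^ 2) := by
  rw [trace]
  split_ifs with hex
  · exact sq_norm_sub_proj_bdrySpace_le M hd hT hϱ hh hN S W k hex.choose_spec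
  -- For the default trace 0 the projection error vanishes.
  · rw [proj, map_zero, sub_zero, norm_zero, zero_pow two_ne_zero]
    positivity

end

/-! ### Conclusion -/

theorem IsPolytope.diam_pos {d : ℕ} (hd : 1 ≤ d) {T : Set (E d)} (hT : IsPolytope T) :
    0 < Metric.diam T := by
  have : Nonempty (Fin d) := ⟨⟨0, hd⟩⟩
  obtain ⟨x, hx⟩ := hT.nonempty
  exact Metric.diam_pos (infinite_of_mem_nhds x (hT.isOpen.mem_nhds hx)).nontrivial hT.isBounded

theorem sq_norm_sub_le {F : Type*} [SeminormedAddCommGroup F] (v p q : F) :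
    ‖v - p‖ ^ 2 ≤ 2 * ‖v - q‖ ^ 2 + 2 * ‖p - q‖ ^ 2 := by
  have h1 : ‖v - p‖ ≤ ‖v - q‖ + ‖p - q‖ := by
    rw [norm_sub_rev p q]; exact norm_sub_le_norm_sub_add_norm_sub v q p
  nlinarith [sq_nonneg (‖v - q‖ - ‖p - q‖), norm_nonneg (v - p)]

end XHHO


theorem mainTheorem4 (d : ℕ) (hd : 2 ≤ d) (Ω : Set (XHHO.E d)) (hΩ : XHHO.IsPolytope Ω)
    (k : ℕ) (ϱ : ℝ) (hϱ : 0 < ϱ) :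
    ∃ C : ℝ, 0 < C ∧
      ∀ (M : XHHO.PolytopalMesh Ω), M.Regular ϱ →
      ∀ (W : Submodule ℝ (XHHO.E d → ℝ)), FiniteDimensional ℝ W → XHHO.IsEnrichment M W →
      ∀ T ∈ M.elements, ∀ v ∈ XHHO.localSpace M W k T,
        (Metric.diam T ^ 2)⁻¹ * ‖v.1 - (XHHO.recon M W k T v).1‖ ^ 2
            ≤ C * XHHO.localForm M W k T v v ∧
        (Metric.diam T)⁻¹ * ‖v.2 - XHHO.trace T (XHHO.recon M W k T v)‖ ^ 2
            ≤ C * XHHO.localForm M W k T v v := by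
  have hd1 : 1 ≤ d := by omega
  set P := (XHHO.poincareConst d ϱ).toReal with hP
  set Q := (XHHO.traceConst d ϱ).toReal with hQ
  have hP0 : 0 ≤ P := ENNReal.toReal_nonneg
  have hQ0 : 0 ≤ Q := ENNReal.toReal_nonneg
  -- The two bounds need max(2, 2P) and max(2, 2Q); the sum serves both.
  refine ⟨2 + 2 * P + 2 * Q, by positivity, fun M hM W _ _ T hTM v _ => ?_⟩
  have hT := M.isPolytope T hTM
  have hh : 0 < Metric.diam T := hT.diam_pos hd1
  obtain ⟨N, hN, ⟨S⟩⟩ := hT.nonempty_starCover hϱ (hM.1 T hTM)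
  set p := XHHO.recon M W k T v with hp
  have hcell := XHHO.sq_norm_sub_proj_cellSpace_le hT hϱ hh hN S W k
    (XHHO.recon_mem_H1 M W k v)
  have hbdry := XHHO.sq_norm_sub_proj_trace_le M hd1 hT hϱ hh hN S W k p
  rw [← hp, ← hP] at hcell
  rw [← hQ] at hbdry
  have h1 := XHHO.sq_norm_sub_le v.1 p.1 (XHHO.proj (XHHO.cellSpace W k T) p.1)
  have h2 := XHHO.sq_norm_sub_le v.2 (XHHO.trace T p)
    (XHHO.proj (XHHO.bdrySpace M W k T) (XHHO.trace T p))
  have hform : XHHO.localForm M W k T v v = ‖p.2‖ ^ 2 +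
      ((Metric.diam T ^ 2)⁻¹ * ‖v.1 - XHHO.proj (XHHO.cellSpace W k T) p.1‖ ^ 2 +
        (Metric.diam T)⁻¹ *
          ‖v.2 - XHHO.proj (XHHO.bdrySpace M W k T) (XHHO.trace T p)‖ ^ 2) := by
    rw [XHHO.localForm, XHHO.stab, real_inner_self_eq_norm_sq, real_inner_self_eq_norm_sq,
      real_inner_self_eq_norm_sq]
    rfl
  rw [hform]
  set h := Metric.diam T
  set G := ‖p.2‖ ^ 2
  set X := (h ^ 2)⁻¹ * ‖v.1 - XHHO.proj (XHHO.cellSpace W k T) p.1‖ ^ 2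
  set Y := h⁻¹ * ‖v.2 - XHHO.proj (XHHO.bdrySpace M W k T) (XHHO.trace T p)‖ ^ 2
  have hG : 0 ≤ G := by positivity
  have hX : 0 ≤ X := by positivity
  have hY : 0 ≤ Y := by positivity
  -- These are the surplus products in the expansion of C (G + X + Y).
  have hrest : 0 ≤ P * X ∧ 0 ≤ P * Y ∧ 0 ≤ Q * X ∧ 0 ≤ Q * Y ∧ 0 ≤ P * G ∧ 0 ≤ Q * G := by
    refine ⟨?_, ?_, ?_, ?_, ?_, ?_⟩ <;> positivity
  constructor
  · have h3 : (h ^ 2)⁻¹ * ‖v.1 - p.1‖ ^ 2 ≤ 2 * X + 2 * (P * G) := by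
      calc _ ≤ (h ^ 2)⁻¹ * (2 * ‖v.1 - XHHO.proj (XHHO.cellSpace W k T) p.1‖ ^ 2 +
            2 * (P * (h ^ 2 * G))) := by gcongr; linarith
        _ = _ := by simp only [X]; field_simp
    nlinarith
  · have h3 : h⁻¹ * ‖v.2 - XHHO.trace T p‖ ^ 2 ≤ 2 * Y + 2 * (Q * G) := by
      calc _ ≤ h⁻¹ * (2 * ‖v.2 - XHHO.proj (XHHO.bdrySpace M W k T) (XHHO.trace T p)‖ ^ 2 +
            2 * (Q * (h * G))) := by gcongr; linarith
        _ = _ := by simp only [Y]; field_simp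
    nlinarith
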